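/- Let $n\in\mathbb N$, $T>0$ and consider the operator $$\partial_t^3+\sum_{j=0}^{2}\sum_{|\alpha|\le 3-j}a_{j,\alpha}(t)\,\partial_t^j\partial_x^\alpha ,\qquad t\in[0,T],\ x\in\mathbb R^n,$$ whose coefficients are real-analytic functions of $t$ in a neighbourhood of $[0,T]$, real-valued if $j+|\alpha|=3$ and possibly complex-valued if $j+|\alpha|\le 2$. For $\xi\in\mathbb R^n$ put $$L(t,\tau,\xi)=\tau^3+\sum_{j\le 2,\ j+|\alpha|=3}a_{j,\alpha}(t)\tau^j\xi^\alpha,\qquad M(t,\tau,\xi)=\sum_{j+|\alpha|=2}a_{j,\alpha}(t)\tau^j\xi^\alpha,$$ $$\check M(t,\tau,\xi)=M(t,\tau,\xi)-\tfrac12\,\partial_t\partial_\tau L(t,\tau,\xi),\qquad \mathcal L(t,\tau,\xi)=L(t,\tau,\xi)-\partial_\tau^2L(t,\tau,\xi).$$ Assume that for all $(t,\xi)\in[0,T]\times\mathbb R^n$ the polynomial $L(t,\cdot,\xi)$ has only real roots $\tau_1(t,\xi)\le\tau_2(t,\xi)\le\tau_3(t,\xi)$ (weak hyperbolicity), and that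 its discriminant $\Delta_L=(\tau_1-\tau_2)^2(\tau_2-\tau_3)^2(\tau_3-\tau_1)^2$ does not vanish identically on $[0,T]\times\mathbb R^n$. Let $S_3=\{(1,2,3),(2,3,1),(3,1,2)\}$. Suppose that there is a constant $C>0$ such that for all $(j,k,l)\in S_3$ $$|\tau_k(t,\xi)-\tau_l(t,\xi)|\,\bigl|\check M(t,\tau_j(t,\xi),\xi)\bigr|\le C\Bigl(\sqrt{\Delta_L(t,\xi)}+\bigl|\partial_t\sqrt{\Delta_L(t,\xi)}\bigr|\Bigr)$$ at every $(t,\xi)\in[0,T]\times\mathbb R^n$ at which $\sqrt{\Delta_L(\cdot,\xi)}$ is differentiable in $t$ (one-sidedly at $t=0$ and $t=T$). Then for $t\in[0,T]$ and $\xi\neq0$ the roots $\lambda_1(t,\xi)<\lambda_2(t,\xi)<\lambda_3(t,\xi)$ of $\mathcal L(t,\cdot,\xi)$ are real and distinct, and the Levi condition holds: for every $r>0$ there is a constant $C_r>0$ such that, for all $\xi\in\mathbb R^n$ with $|\xi|\ge r$, the integrand below is integrable on $[0,T]$ and $$\int_0^T\sum_{(j,k,l)\in S_3}\frac{\bigl|\check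 M(t,\lambda_j(t,\xi),\xi)\bigr|}{|\lambda_j(t,\xi)-\lambda_k(t,\xi)|\,|\lambda_j(t,\xi)-\lambda_l(t,\xi)|}\,dt\le C_r\log(1+|\xi|).$$ -/

import Mathlib

open Polynomial Set MeasureTheory

noncomputable section

/-- The coefficients of a third order operator
`∂ₜ³ + ∑_{j ≤ 2} ∑_{|α| ≤ 3 - j} a_{j,α}(t) ∂ₜ^j ∂ₓ^α` on `ℝ × ℝⁿ`, depending only on time.
Only the indices with `j ≤ 2` and `j + |α| ≤ 3` matter. The coefficients of the principal part
(`j + |α| = 3`) are real, those of the lower order terms (`j + |α| ≤ 2`) may be complex. -/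
structure ThirdOrderOperator (n : ℕ) where
  /-- `a_{j,α}` for `j + |α| = 3` -/
  top : ℕ → (Fin n → ℕ) → ℝ → ℝ
  /-- `a_{j,α}` for `j + |α| ≤ 2` -/
  low : ℕ → (Fin n → ℕ) → ℝ → ℂ

/-- The set `{(1,2,3), (2,3,1), (3,1,2)}`, with indices shifted to start at `0`. -/
def cyclicTriples : Finset (Fin 3 × Fin 3 × Fin 3) :=
  {(0, 1, 2), (1, 2, 0), (2, 0, 1)}

/-- The `j`-th real root of `P`, the roots being listed in nondecreasing order and repeated
according to multiplicity (used for cubics all of whose roots are real). -/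
def orderedRoot (P : ℝ[X]) (j : Fin 3) : ℝ :=
  (P.roots.sort (· ≤ ·)).getD j 0

namespace ThirdOrderOperator

variable {n : ℕ}

/-- All coefficients are real analytic (in a neighbourhood of each point) on `[0,T]`. -/
def AnalyticCoeffs (P : ThirdOrderOperator n) (T : ℝ) : Prop :=
  (∀ (j : ℕ) (α : Fin n → ℕ), j ≤ 2 → j + ∑ i, α i = 3 →
    AnalyticOnNhd ℝ (P.top j α) (Icc 0 T)) ∧
  (∀ (j : ℕ) (α : Fin n → ℕ), j + ∑ i, α i ≤ 2 →
    AnalyticOnNhd ℝ (P.low j α) (Icc 0 T))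

/-- The principal symbol `L(t,τ,ξ) = τ³ + ∑_{j ≤ 2} ∑_{|α| = 3 - j} a_{j,α}(t) τ^j ξ^α`,
as a polynomial in `τ`. -/
def L (P : ThirdOrderOperator n) (t : ℝ) (ξ : EuclideanSpace ℝ (Fin n)) : ℝ[X] :=
  X ^ 3 + ∑ j ∈ Finset.range 3, ∑ α ∈ Finset.piAntidiag (Finset.univ : Finset (Fin n)) (3 - j),
    C (P.top j α t * ∏ i, ξ i ^ α i) * X ^ j

/-- The second order symbol `M(t,τ,ξ) = ∑_{j + |α| = 2} a_{j,α}(t) τ^j ξ^α`. -/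
def M (P : ThirdOrderOperator n) (t τ : ℝ) (ξ : EuclideanSpace ℝ (Fin n)) : ℂ :=
  ∑ j ∈ Finset.range 3, ∑ α ∈ Finset.piAntidiag (Finset.univ : Finset (Fin n)) (2 - j),
    P.low j α t * ((τ ^ j * ∏ i, ξ i ^ α i : ℝ) : ℂ)

/-- The modified symbol `M(t,τ,ξ) - (1/2) ∂ₜ ∂_τ L(t,τ,ξ)`. -/
def MCheck (P : ThirdOrderOperator n) (t τ : ℝ) (ξ : EuclideanSpace ℝ (Fin n)) : ℂ :=
  P.M t τ ξ - ((1 / 2 * deriv (fun s => (derivative (P.L s ξ)).eval τ) t : ℝ) : ℂ)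

/-- Weak hyperbolicity on `[0,T]`: `L(t,·,ξ)` has only real roots. -/
def WeaklyHyperbolic (P : ThirdOrderOperator n) (T : ℝ) : Prop :=
  ∀ t ∈ Icc 0 T, ∀ ξ : EuclideanSpace ℝ (Fin n), (P.L t ξ).Splits

/-- The roots `τ₁ ≤ τ₂ ≤ τ₃` of `L(t,·,ξ)`. -/
def tau (P : ThirdOrderOperator n) (j : Fin 3) (t : ℝ) (ξ : EuclideanSpace ℝ (Fin n)) : ℝ :=
  orderedRoot (P.L t ξ) j

/-- The discriminant `Δ_L = (τ₁ - τ₂)² (τ₂ - τ₃)² (τ₃ - τ₁)²`. -/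
def discrL (P : ThirdOrderOperator n) (t : ℝ) (ξ : EuclideanSpace ℝ (Fin n)) : ℝ :=
  (P.tau 0 t ξ - P.tau 1 t ξ) ^ 2 * (P.tau 1 t ξ - P.tau 2 t ξ) ^ 2 *
    (P.tau 2 t ξ - P.tau 0 t ξ) ^ 2

/-- The auxiliary polynomial `𝓛 = L - ∂_τ² L`. -/
def calL (P : ThirdOrderOperator n) (t : ℝ) (ξ : EuclideanSpace ℝ (Fin n)) : ℝ[X] :=
  P.L t ξ - derivative (derivative (P.L t ξ))

/-- The roots `λ₁ < λ₂ < λ₃` of `𝓛(t,·,ξ)`. -/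
def lam (P : ThirdOrderOperator n) (j : Fin 3) (t : ℝ) (ξ : EuclideanSpace ℝ (Fin n)) : ℝ :=
  orderedRoot (P.calL t ξ) j

/-- The pointwise condition
`|τ_k - τ_l| |M̌(t,τ_j,ξ)| ≤ C (√Δ_L + |∂ₜ √Δ_L|)` on `[0,T] × ℝⁿ`, for each cyclic triple
`(j,k,l)`. It is required wherever its right-hand side makes sense, that is, at
every `(t,ξ)` such that `√Δ_L(·,ξ)` is differentiable at `t` (one-sidedly at `0` and `T`). -/
def PointwiseBound (P : ThirdOrderOperator n) (T : ℝ) : Prop :=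
  ∃ K : ℝ, 0 < K ∧ ∀ q ∈ cyclicTriples, ∀ t ∈ Icc 0 T, ∀ ξ : EuclideanSpace ℝ (Fin n),
    DifferentiableWithinAt ℝ (fun s => √(P.discrL s ξ)) (Icc 0 T) t →
      |P.tau q.2.1 t ξ - P.tau q.2.2 t ξ| * ‖P.MCheck t (P.tau q.1 t ξ) ξ‖ ≤
        K * (√(P.discrL t ξ) + |derivWithin (fun s => √(P.discrL s ξ)) (Icc 0 T) t|)

/-- The integrand `∑_{(j,k,l)} |M̌(t,λ_j,ξ)| / (|λ_j - λ_k| |λ_j - λ_l|)`. -/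
def leviIntegrand (P : ThirdOrderOperator n) (ξ : EuclideanSpace ℝ (Fin n)) (t : ℝ) : ℝ :=
  ∑ q ∈ cyclicTriples, ‖P.MCheck t (P.lam q.1 t ξ) ξ‖ /
    (|P.lam q.1 t ξ - P.lam q.2.1 t ξ| * |P.lam q.1 t ξ - P.lam q.2.2 t ξ|)

/-- The Levi condition
`∫₀ᵀ ∑_{(j,k,l)} |M̌(t,λ_j,ξ)| / (|λ_j - λ_k| |λ_j - λ_l|) dt ≲ log (1 + |ξ|)`.
The constant is uniform on `{|ξ| ≥ r}`, for each `r > 0`. The first clause (`𝓛(t,·,ξ)` has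
three distinct real roots) and the integrability say that the left-hand side is meaningful. -/
def LeviCondition (P : ThirdOrderOperator n) (T : ℝ) : Prop :=
  (∀ t ∈ Icc 0 T, ∀ ξ : EuclideanSpace ℝ (Fin n), ξ ≠ 0 →
    (P.calL t ξ).Splits ∧ (P.calL t ξ).roots.Nodup) ∧
  ∀ r : ℝ, 0 < r → ∃ K : ℝ, 0 < K ∧ ∀ ξ : EuclideanSpace ℝ (Fin n), r ≤ ‖ξ‖ →
    IntervalIntegrable (P.leviIntegrand ξ) volume 0 T ∧
    ∫ t in (0 : ℝ)..T, P.leviIntegrand ξ t ≤ K * Real.log (1 + ‖ξ‖)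

end ThirdOrderOperator

end

/-! The argument has an algebraic half and an analytic half.

Algebraic half. Passing from `L` to `L - ∂_τ² L` moves each ordered root by at most 3 and makes
adjacent roots at least 1 apart (`NuijRoots`). As `M̌` is quadratic in `τ`, Lagrange interpolation
at the `τ_j` bounds each quotient `|M̌(λ_j)| / (|λ_j - λ_k| |λ_j - λ_l|)` by 16 times the sum of the
same quotients at the `τ_j` (`nodeQuotient_le`). Multiplied by `√Δ`, the quotient at `τ_j` is `|τ_k
- τ_l| |M̌(τ_j)|`, so the pointwise hypothesis bounds the Levi integrand by `K (1 + |∂ₜΔ| / Δ)`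
wherever `Δ ≠ 0` (`exists_leviIntegrand_le`). The unit gaps also make the integrand grow at most
polynomially in `ξ`.

Analytic half. It remains to integrate a logarithmic derivative truncated at a height `R` that is a
power of `1 + |ξ|`, up to a constant factor. If some derivative of `f ≥ 0` stays away from zero,
then `f` has a bounded number of monotone pieces, and on every interval of length `1/R` it reaches a
fixed power of `1/R`. On each piece an interval of length `1/R` costs at most 1 and the rest
telescopes to `O(log R)` (`exists_lintegral_le_log_of_iterated`). Uniformity in `ξ` holds because
`Δ(·,ξ)` ranges in a fixed finite dimensional space of analytic functions: the estimate is invariant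
under scaling, so compactness of a unit sphere and of `[0,T]` suffices
(`exists_uniform_logDerivBound`).

Frequencies at which `Δ(·,ξ)` vanishes identically are limits, along a line, of frequencies at which
it does not. The integrand is continuous in `ξ`, and Fatou's lemma carries the bound over. -/

/-! ### One-variable estimates for truncated logarithmic derivatives. -/

/-- `f k` has derivative `f (k + 1)` at every point of `s`, for each `k`. -/
def IsDerivTower (f : ℕ → ℝ → ℝ) (s : Set ℝ) : Prop :=
  ∀ k, ∀ t ∈ s, HasDerivAt (f k) (f (k + 1) t) t

namespace IsDerivTower

variable {f : ℕ → ℝ → ℝ} {s s' : Set ℝ}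

theorem mono (h : IsDerivTower f s) (hs : s' ⊆ s) : IsDerivTower f s' :=
  fun k t ht => h k t (hs ht)

theorem neg (h : IsDerivTower f s) : IsDerivTower (fun k t => -f k t) s :=
  fun k t ht => (h k t ht).neg

theorem continuousOn (h : IsDerivTower f s) (k : ℕ) : ContinuousOn (f k) s :=
  fun t ht => (h k t ht).continuousAt.continuousWithinAt

theorem mul_sub_le {a b κ : ℝ} {k : ℕ} (h : IsDerivTower f (Icc a b))
    (hκ : ∀ t ∈ Icc a b, κ ≤ f (k + 1) t) {x y : ℝ} (hx : x ∈ Icc a b) (hy : y ∈ Icc a b)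
    (hxy : x ≤ y) : κ * (y - x) ≤ f k y - f k x := by
  refine (convex_Icc a b).mul_sub_le_image_sub_of_le_deriv (h.continuousOn k) ?_ ?_ x hx y hy hxy
  · exact fun t ht => (h k t (interior_subset ht)).differentiableAt.differentiableWithinAt
  · intro t ht
    rw [(h k t (interior_subset ht)).deriv]
    exact hκ t (interior_subset ht)

theorem monotoneOn {a b : ℝ} {k : ℕ} (h : IsDerivTower f (Icc a b))
    (hk : ∀ t ∈ Icc a b, 0 ≤ f (k + 1) t) : MonotoneOn (f k) (Icc a b) := by
  intro x hx y hy hxy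
  have := h.mul_sub_le hk hx hy hxy
  linarith

end IsDerivTower

/-- A function whose `m`-th derivative is at least `κ` on an interval of length `ℓ` takes a value
of modulus at least `c κ ℓ ^ m` there. -/
theorem exists_large_value (m : ℕ) : ∃ c : ℝ, 0 < c ∧ ∀ (f : ℕ → ℝ → ℝ) (a b κ : ℝ), a ≤ b →
    IsDerivTower f (Icc a b) → (∀ t ∈ Icc a b, κ ≤ f m t) →
    ∃ t ∈ Icc a b, c * κ * (b - a) ^ m ≤ |f 0 t| := by
  induction m with
  | zero =>
    refine ⟨1, one_pos, fun f a b κ hab _ hκ => ⟨a, left_mem_Icc.2 hab, ?_⟩⟩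
    have := hκ a (left_mem_Icc.2 hab)
    simpa using this.trans (le_abs_self _)
  | succ m ih =>
    obtain ⟨c, hc, H⟩ := ih
    refine ⟨c / 2 ^ (m + 2), by positivity, fun f a b κ hab hf hκ => ?_⟩
    -- The induction hypothesis is applied to the increment `f (t + h) - f t`, whose `m`-th
    -- derivative is at least `κ h`. One of the two values carries half of the increment; with `h ^
    -- (m + 1)` this accounts for `2 ^ (m + 2)`.
    set h : ℝ := (b - a) / 2 with hh
    have hh0 : 0 ≤ h := by linarith
    have hsub : ∀ t ∈ Icc a (a + h), t ∈ Icc a b ∧ t + h ∈ Icc a b := fun t ht =>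
      ⟨⟨ht.1, by linarith [ht.2]⟩, ⟨by linarith [ht.1], by linarith [ht.2]⟩⟩
    obtain ⟨t, ht, hle⟩ := H (fun k t => f k (t + h) - f k t) a (a + h) (κ * h) (by linarith)
      (fun k t ht => ((hf k _ (hsub t ht).2).comp_add_const t h).sub (hf k t (hsub t ht).1))
      (fun t ht => by
        have := hf.mul_sub_le hκ (hsub t ht).1 (hsub t ht).2 (by linarith)
        simpa using this)
    have hval : c * (κ * h) * (a + h - a) ^ m = 2 * (c / 2 ^ (m + 2) * κ * (b - a) ^ (m + 1)) := by
      rw [hh, add_sub_cancel_left, div_pow, pow_succ (b - a), pow_add]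
      field_simp
    rw [hval] at hle
    have := abs_sub (f 0 (t + h)) (f 0 t)
    rcases le_total |f 0 (t + h)| |f 0 t| with h1 | h1
    · exact ⟨t, (hsub t ht).1, by linarith⟩
    · exact ⟨t + h, (hsub t ht).2, by linarith⟩

/-- `g` has constant (weak) sign on `[a,b]`. -/
def HasConstSign (g : ℝ → ℝ) (a b : ℝ) : Prop :=
  (∀ t ∈ Icc a b, 0 ≤ g t) ∨ ∀ t ∈ Icc a b, g t ≤ 0

theorem HasConstSign.mono {g : ℝ → ℝ} {a b a' b' : ℝ} (h : HasConstSign g a b)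
    (hs : Icc a' b' ⊆ Icc a b) : HasConstSign g a' b' :=
  h.imp (fun h t ht => h t (hs ht)) fun h t ht => h t (hs ht)

theorem exists_constSign_split_of_monotoneOn {g : ℝ → ℝ} {a b : ℝ} (hab : a ≤ b)
    (hg : ContinuousOn g (Icc a b)) (hm : MonotoneOn g (Icc a b)) :
    ∃ c ∈ Icc a b, HasConstSign g a c ∧ HasConstSign g c b := by
  have ha := left_mem_Icc.2 hab
  have hb := right_mem_Icc.2 hab
  rcases le_total 0 (g a) with h0 | h0
  · have : HasConstSign g a b := Or.inl fun t ht => h0.trans (hm ha ht ht.1)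
    exact ⟨a, ha, this.mono (Icc_subset_Icc_right hab), this⟩
  rcases le_total (g b) 0 with h1 | h1
  · have : HasConstSign g a b := Or.inr fun t ht => (hm ht hb ht.2).trans h1
    exact ⟨b, hb, this, this.mono (Icc_subset_Icc_left hab)⟩
  obtain ⟨c, hc, hc0⟩ := intermediate_value_Icc hab hg ⟨h0, h1⟩
  refine ⟨c, hc, Or.inr fun t ht => ?_, Or.inl fun t ht => ?_⟩
  · rw [← hc0]; exact hm ⟨ht.1, ht.2.trans hc.2⟩ hc ht.2
  · rw [← hc0]; exact hm hc ⟨hc.1.trans ht.1, ht.2⟩ ht.1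

/-- A monotone function changes sign at most once, so each step down the tower at most doubles the
number of sign pieces. -/
theorem IsDerivTower.exists_constSign_split {f : ℕ → ℝ → ℝ} {a b : ℝ} {k : ℕ} (hab : a ≤ b)
    (h : IsDerivTower f (Icc a b)) (hk : HasConstSign (f (k + 1)) a b) :
    ∃ c ∈ Icc a b, HasConstSign (f k) a c ∧ HasConstSign (f k) c b := by
  rcases hk with hk | hk
  · exact exists_constSign_split_of_monotoneOn hab (h.continuousOn k) (h.monotoneOn hk)
  · obtain ⟨c, hc, h1, h2⟩ := exists_constSign_split_of_monotoneOn hab (h.neg.continuousOn k)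
      (h.neg.monotoneOn fun t ht => neg_nonneg.2 (hk t ht))
    have key : ∀ x y, HasConstSign (fun t => -f k t) x y → HasConstSign (f k) x y := by
      intro x y hxy
      rcases hxy with hxy | hxy
      · exact Or.inr fun t ht => neg_nonneg.1 (hxy t ht)
      · exact Or.inl fun t ht => neg_nonpos.1 (hxy t ht)
    exact ⟨c, hc, key _ _ h1, key _ _ h2⟩

/-- If the lower integral of `u` over every subinterval on which `f 1` has constant sign is at most
`B`, then it is at most `2 ^ k B` over an interval on which `f (k + 1)` has constant sign. -/
theorem IsDerivTower.lintegral_le_of_constSign {f : ℕ → ℝ → ℝ} {u : ℝ → ENNReal} {B : ENNReal}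
    (k : ℕ) : ∀ a b : ℝ, a ≤ b → IsDerivTower f (Icc a b) → HasConstSign (f (k + 1)) a b →
    (∀ x y, x ≤ y → Icc x y ⊆ Icc a b → HasConstSign (f 1) x y → ∫⁻ t in Icc x y, u t ≤ B) →
    ∫⁻ t in Icc a b, u t ≤ 2 ^ k * B := by
  induction k with
  | zero =>
    intro a b hab _ hs hB
    simpa using hB a b hab Subset.rfl hs
  | succ k ih =>
    intro a b hab hf hs hB
    obtain ⟨c, hc, h1, h2⟩ := hf.exists_constSign_split hab hs
    have s1 : Icc a c ⊆ Icc a b := Icc_subset_Icc_right hc.2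
    have s2 : Icc c b ⊆ Icc a b := Icc_subset_Icc_left hc.1
    calc ∫⁻ t in Icc a b, u t = ∫⁻ t in Icc a c ∪ Icc c b, u t := by
          rw [Icc_union_Icc_eq_Icc hc.1 hc.2]
      _ ≤ 2 ^ k * B + 2 ^ k * B := (lintegral_union_le _ _ _).trans <| add_le_add
          (ih a c hc.1 (hf.mono s1) h1 fun x y hxy hs => hB x y hxy (hs.trans s1))
          (ih c b hc.2 (hf.mono s2) h2 fun x y hxy hs => hB x y hxy (hs.trans s2))
      _ = 2 ^ (k + 1) * B := by ring

/-- A lower integral bound by the logarithmic oscillation of a positive monotone function. -/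
theorem lintegral_le_log_of_constSign {f f' u : ℝ → ℝ} {p q ε S : ℝ} (hpq : p ≤ q) (hε : 0 < ε)
    (hf : ∀ t ∈ Icc p q, HasDerivAt f (f' t) t) (hf' : ContinuousOn f' (Icc p q))
    (hs : HasConstSign f' p q) (hεf : ∀ t ∈ Icc p q, ε ≤ f t) (hS : ∀ t ∈ Icc p q, f t ≤ S)
    (hu : ∀ t ∈ Icc p q, u t * f t ≤ |f' t|) :
    ∫⁻ t in Icc p q, ENNReal.ofReal (u t) ≤ ENNReal.ofReal (Real.log (S / ε)) := by
  have hpos : ∀ t ∈ Icc p q, 0 < f t := fun t ht => hε.trans_le (hεf t ht)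
  have hfc : ContinuousOn f (Icc p q) := fun t ht => (hf t ht).continuousAt.continuousWithinAt
  have hlog : ∀ x ∈ Icc p q, ∀ y ∈ Icc p q, Real.log (f x) - Real.log (f y) ≤ Real.log (S / ε) := by
    intro x hx y hy
    rw [← Real.log_div (hpos x hx).ne' (hpos y hy).ne']
    exact Real.log_le_log (div_pos (hpos x hx) (hpos y hy))
      (div_le_div₀ ((hpos x hx).le.trans (hS x hx)) (hS x hx) hε (hεf y hy))
  have hcont : ContinuousOn (fun t => f' t / f t) (Icc p q) :=
    hf'.div hfc fun t ht => (hpos t ht).ne'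
  have hFTC : ∫ t in Icc p q, f' t / f t = Real.log (f q) - Real.log (f p) := by
    rw [integral_Icc_eq_integral_Ioc, ← intervalIntegral.integral_of_le hpq]
    refine intervalIntegral.integral_eq_sub_of_hasDerivAt (f := fun t => Real.log (f t)) ?_ ?_
    · intro t ht
      rw [uIcc_of_le hpq] at ht
      exact (hf t ht).log (hpos t ht).ne'
    · exact ContinuousOn.intervalIntegrable (by rwa [uIcc_of_le hpq])
  have hint : IntegrableOn (fun t => f' t / f t) (Icc p q) := hcont.integrableOn_Icc
  have hp := left_mem_Icc.2 hpq
  have hq := right_mem_Icc.2 hpq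
  have hu' : ∀ t ∈ Icc p q, u t ≤ |f' t| / f t := fun t ht => by
    rw [le_div_iff₀ (hpos t ht)]; exact hu t ht
  rcases hs with hs | hs
  · calc ∫⁻ t in Icc p q, ENNReal.ofReal (u t)
        ≤ ∫⁻ t in Icc p q, ENNReal.ofReal (f' t / f t) :=
          setLIntegral_mono' measurableSet_Icc fun t ht => ENNReal.ofReal_le_ofReal <| by
            simpa only [abs_of_nonneg (hs t ht)] using hu' t ht
      _ = ENNReal.ofReal (∫ t in Icc p q, f' t / f t) :=
          (ofReal_integral_eq_lintegral_ofReal hint <|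
            (ae_restrict_iff' measurableSet_Icc).2 <| Filter.Eventually.of_forall fun t ht =>
              div_nonneg (hs t ht) (hpos t ht).le).symm
      _ ≤ _ := ENNReal.ofReal_le_ofReal (hFTC ▸ hlog q hq p hp)
  · calc ∫⁻ t in Icc p q, ENNReal.ofReal (u t)
        ≤ ∫⁻ t in Icc p q, ENNReal.ofReal (-(f' t / f t)) :=
          setLIntegral_mono' measurableSet_Icc fun t ht => ENNReal.ofReal_le_ofReal <| by
            simpa only [abs_of_nonpos (hs t ht), neg_div] using hu' t ht
      _ = ENNReal.ofReal (∫ t in Icc p q, -(f' t / f t)) :=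
          (ofReal_integral_eq_lintegral_ofReal hint.neg <|
            (ae_restrict_iff' measurableSet_Icc).2 <| Filter.Eventually.of_forall fun t ht =>
              neg_nonneg.2 (div_nonpos_of_nonpos_of_nonneg (hs t ht) (hpos t ht).le)).symm
      _ ≤ _ := ENNReal.ofReal_le_ofReal <| by
          rw [integral_neg, hFTC, neg_sub]; exact hlog p hp q hq

theorem lintegral_Icc_le_of_le {u : ℝ → ℝ} {p q R : ℝ} (hR : 0 ≤ R) (hu : ∀ t ∈ Icc p q, u t ≤ R) :
    ∫⁻ t in Icc p q, ENNReal.ofReal (u t) ≤ ENNReal.ofReal (R * (q - p)) := by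
  calc ∫⁻ t in Icc p q, ENNReal.ofReal (u t) ≤ ∫⁻ _ in Icc p q, ENNReal.ofReal R :=
        setLIntegral_mono' measurableSet_Icc fun t ht => ENNReal.ofReal_le_ofReal (hu t ht)
    _ = ENNReal.ofReal (R * (q - p)) := by
        rw [setLIntegral_const, Real.volume_Icc, ← ENNReal.ofReal_mul hR]

/-- The logarithmic bound on a piece of monotonicity. If a nonnegative `f` has a large value on every
subinterval of length `> ℓ`, then the truncated logarithmic derivative has small integral. -/
theorem lintegral_le_of_monotone_piece {f f' u : ℝ → ℝ} {p q ε ℓ R S : ℝ}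
    (hε : 0 < ε) (hR : 0 ≤ R) (hℓ : 0 ≤ ℓ)
    (hf : ∀ t ∈ Icc p q, HasDerivAt f (f' t) t) (hf' : ContinuousOn f' (Icc p q))
    (hs : HasConstSign f' p q) (hS : ∀ t ∈ Icc p q, f t ≤ S) (hSε : ε ≤ S)
    (hlarge : ∀ x y, x + ℓ ≤ y → Icc x y ⊆ Icc p q → ∃ t ∈ Icc x y, ε ≤ f t)
    (huR : ∀ t ∈ Icc p q, u t ≤ R) (hu : ∀ t ∈ Icc p q, u t * f t ≤ |f' t|) :
    ∫⁻ t in Icc p q, ENNReal.ofReal (u t) ≤ ENNReal.ofReal (R * ℓ + Real.log (S / ε)) := by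
  have hlog : 0 ≤ Real.log (S / ε) := Real.log_nonneg ((one_le_div hε).2 hSε)
  have hfc : ContinuousOn f (Icc p q) := fun t ht => (hf t ht).continuousAt.continuousWithinAt
  -- A piece shorter than `ℓ` is covered by the trivial bound `u ≤ R` alone.
  rcases lt_or_ge q (p + ℓ) with hlt | hge
  · refine (lintegral_Icc_le_of_le hR huR).trans (ENNReal.ofReal_le_ofReal ?_)
    have : R * (q - p) ≤ R * ℓ := mul_le_mul_of_nonneg_left (by linarith) hR
    linarith
  rw [ENNReal.ofReal_add (mul_nonneg hR hℓ) hlog]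
  have hdiff : ∀ t ∈ interior (Icc p q), deriv f t = f' t := fun t ht =>
    (hf t (interior_subset ht)).deriv
  have hdo : DifferentiableOn ℝ f (interior (Icc p q)) := fun t ht =>
    (hf t (interior_subset ht)).differentiableAt.differentiableWithinAt
  have split : ∀ c ∈ Icc p q, ∫⁻ t in Icc p q, ENNReal.ofReal (u t) ≤
      (∫⁻ t in Icc p c, ENNReal.ofReal (u t)) + ∫⁻ t in Icc c q, ENNReal.ofReal (u t) := by
    intro c hc
    rw [← Icc_union_Icc_eq_Icc hc.1 hc.2]
    exact lintegral_union_le _ _ _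
  -- If `f` increases, it exceeds `ε` after the first stretch of length `ℓ`; if it decreases, it
  -- does so before the last one. The exceptional stretch costs `R ℓ`, the rest a logarithm.
  rcases hs with hs | hs
  · have hmono : MonotoneOn f (Icc p q) := monotoneOn_of_deriv_nonneg (convex_Icc p q) hfc hdo
      fun t ht => (hdiff t ht).symm ▸ hs t (interior_subset ht)
    have hc : p + ℓ ∈ Icc p q := ⟨by linarith, hge⟩
    have s1 : Icc p (p + ℓ) ⊆ Icc p q := Icc_subset_Icc_right hc.2
    have s2 : Icc (p + ℓ) q ⊆ Icc p q := Icc_subset_Icc_left hc.1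
    obtain ⟨t₀, ht₀, h₀⟩ := hlarge p (p + ℓ) le_rfl s1
    refine (split _ hc).trans (add_le_add ?_ ?_)
    · simpa using lintegral_Icc_le_of_le hR fun t ht => huR t (s1 ht)
    · exact lintegral_le_log_of_constSign hc.2 hε (fun t ht => hf t (s2 ht)) (hf'.mono s2)
        (Or.inl fun t ht => hs t (s2 ht))
        (fun t ht => h₀.trans (hmono (s1 ht₀) (s2 ht) (ht₀.2.trans ht.1)))
        (fun t ht => hS t (s2 ht)) fun t ht => hu t (s2 ht)
  · have hmono : AntitoneOn f (Icc p q) := antitoneOn_of_deriv_nonpos (convex_Icc p q) hfc hdo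
      fun t ht => (hdiff t ht).symm ▸ hs t (interior_subset ht)
    have hc : q - ℓ ∈ Icc p q := ⟨by linarith, by linarith⟩
    have s1 : Icc p (q - ℓ) ⊆ Icc p q := Icc_subset_Icc_right hc.2
    have s2 : Icc (q - ℓ) q ⊆ Icc p q := Icc_subset_Icc_left hc.1
    obtain ⟨t₀, ht₀, h₀⟩ := hlarge (q - ℓ) q (by linarith) s2
    refine (split _ hc).trans ((add_comm _ _).trans_le (add_le_add ?_ ?_))
    · simpa using lintegral_Icc_le_of_le hR fun t ht => huR t (s2 ht)
    · exact lintegral_le_log_of_constSign hc.1 hε (fun t ht => hf t (s1 ht)) (hf'.mono s1)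
        (Or.inr fun t ht => hs t (s1 ht))
        (fun t ht => h₀.trans (hmono (s1 ht) (s2 ht₀) (ht.2.trans ht₀.1)))
        (fun t ht => hS t (s1 ht)) fun t ht => hu t (s1 ht)

/-- The truncated logarithmic derivative of a nonnegative function whose `m`-th derivative is bounded
below in modulus has integral `O(log R)`, where `R` is the truncation. -/
theorem exists_lintegral_le_log_of_iterated (m : ℕ) {κ S : ℝ} (hκ : 0 < κ) :
    ∃ K : ℝ, 0 < K ∧ ∀ (f : ℕ → ℝ → ℝ) (a b : ℝ), a ≤ b → IsDerivTower f (Icc a b) →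
      ((∀ t ∈ Icc a b, κ ≤ f (m + 1) t) ∨ ∀ t ∈ Icc a b, f (m + 1) t ≤ -κ) →
      (∀ t ∈ Icc a b, 0 ≤ f 0 t ∧ f 0 t ≤ S) →
      ∀ (R : ℝ) (u : ℝ → ℝ), 2 ≤ R → (∀ t ∈ Icc a b, u t ≤ R) →
        (∀ t ∈ Icc a b, u t * f 0 t ≤ |f 1 t|) →
        ∫⁻ t in Icc a b, ENNReal.ofReal (u t) ≤ ENNReal.ofReal (K * Real.log R) := by
  obtain ⟨c, hc, H⟩ := exists_large_value (m + 1)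
  -- The maximum guarantees `ε ≤ S'` below, which keeps the logarithm nonnegative even if `S` is
  -- small.
  set S' : ℝ := max S (c * κ) with hS'
  have hcκ : 0 < c * κ := mul_pos hc hκ
  have hS'0 : 0 < S' := hcκ.trans_le (le_max_right _ _)
  set A : ℝ := 1 + Real.log (S' / (c * κ)) with hA
  have hA0 : 0 < A := by
    have : 0 ≤ Real.log (S' / (c * κ)) := Real.log_nonneg ((one_le_div hcκ).2 (le_max_right _ _))
    linarith
  have hl2 : 0 < Real.log 2 := Real.log_pos one_lt_two
  refine ⟨2 ^ m * (A / Real.log 2 + (m + 1)), by positivity, ?_⟩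
  intro f a b hab hf hsign hS R u hR huR hu
  have hR0 : 0 < R := by linarith
  have hRl : Real.log 2 ≤ Real.log R := Real.log_le_log two_pos hR
  -- This is the value forced by `exists_large_value` on an interval of length `R⁻¹`. With `ℓ = R⁻¹`
  -- the exceptional stretches cost 1 each, and `log (S' / ε)` is linear in `log R`.
  set ε : ℝ := c * κ * R⁻¹ ^ (m + 1) with hε
  have hε0 : 0 < ε := by positivity
  have hεS : ε ≤ S' := by
    refine le_trans ?_ (le_max_right _ _)
    exact mul_le_of_le_one_right hcκ.le
      (pow_le_one₀ (by positivity) (inv_le_one_of_one_le₀ (by linarith)))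
  have hlarge : ∀ x y, x + R⁻¹ ≤ y → Icc x y ⊆ Icc a b → ∃ t ∈ Icc x y, ε ≤ f 0 t := by
    intro x y hxy hs
    have hRi : 0 < R⁻¹ := by positivity
    have hpow : ε ≤ c * κ * (y - x) ^ (m + 1) := by
      rw [hε]
      gcongr
      linarith
    have hle : x ≤ y := by linarith
    rcases hsign with h | h
    · obtain ⟨t, ht, hl⟩ := H f x y κ hle (hf.mono hs) fun t ht => h t (hs ht)
      rw [abs_of_nonneg (hS t (hs ht)).1] at hl
      exact ⟨t, ht, hpow.trans hl⟩
    · obtain ⟨t, ht, hl⟩ := H _ x y κ hle (hf.mono hs).neg fun t ht => by linarith [h t (hs ht)]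
      rw [abs_neg, abs_of_nonneg (hS t (hs ht)).1] at hl
      exact ⟨t, ht, hpow.trans hl⟩
  have hcs : HasConstSign (f (m + 1)) a b := hsign.imp (fun h t ht => hκ.le.trans (h t ht))
    fun h t ht => (h t ht).trans (by linarith)
  have hmain := hf.lintegral_le_of_constSign (u := fun t => ENNReal.ofReal (u t))
    (B := ENNReal.ofReal (R * R⁻¹ + Real.log (S' / ε))) m a b hab hcs
    (fun x y _ hs h1 => lintegral_le_of_monotone_piece hε0 hR0.le (by positivity)
      (fun t ht => hf 0 t (hs ht)) ((hf.continuousOn 1).mono hs) h1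
      (fun t ht => (hS t (hs ht)).2.trans (le_max_left _ _)) hεS
      (fun x' y' h' hs' => hlarge x' y' h' (hs'.trans hs)) (fun t ht => huR t (hs ht))
      fun t ht => hu t (hs ht))
  refine hmain.trans ?_
  have h2 : (2 : ENNReal) ^ m = ENNReal.ofReal (2 ^ m) := by
    rw [ENNReal.ofReal_pow (by norm_num)]; simp
  rw [h2, ← ENNReal.ofReal_mul (by positivity)]
  apply ENNReal.ofReal_le_ofReal
  have hlogε : Real.log (S' / ε) = Real.log (S' / (c * κ)) + (m + 1) * Real.log R := by
    rw [hε, Real.log_div hS'0.ne' hε0.ne', Real.log_mul hcκ.ne' (by positivity), Real.log_pow,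
      Real.log_inv, Real.log_div hS'0.ne' hcκ.ne']
    push_cast
    ring
  rw [hlogε, mul_inv_cancel₀ hR0.ne', mul_assoc]
  refine mul_le_mul_of_nonneg_left ?_ (by positivity)
  -- Constants are absorbed into `log R` thanks to `R ≥ 2`.
  have : A ≤ A / Real.log 2 * Real.log R := by
    rw [div_mul_eq_mul_div, le_div_iff₀ hl2]
    exact mul_le_mul_of_nonneg_left hRl hA0.le
  rw [add_mul]
  linarith

/-! ### Real cubics, their ordered roots and their coefficients. -/

theorem orderedRoot_of_eq {P : ℝ[X]} {a b c : ℝ} (hab : a ≤ b) (hbc : b ≤ c)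
    (h : P = (X - C a) * (X - C b) * (X - C c)) :
    orderedRoot P 0 = a ∧ orderedRoot P 1 = b ∧ orderedRoot P 2 = c := by
  have hr : P.roots = ([a, b, c] : Multiset ℝ) := by
    rw [h, roots_mul (by simp [X_sub_C_ne_zero]), roots_mul (by simp [X_sub_C_ne_zero])]
    simp only [roots_X_sub_C]
    rfl
  have hs : P.roots.sort (· ≤ ·) = [a, b, c] := by
    rw [hr, Multiset.coe_sort]
    apply List.mergeSort_of_pairwise
    simp [hab, hbc, hab.trans hbc]
  simp [orderedRoot, hs]

/-- The monic cubic `X³ + A X² + B X + D`. -/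
noncomputable def monicCubic (A B D : ℝ) : ℝ[X] := X ^ 3 + C A * X ^ 2 + C B * X + C D

theorem monicCubic_eq_prod {A B D a b c : ℝ} (hA : A = -(a + b + c)) (hB : B = a * b + b * c + c * a)
    (hD : D = -(a * b * c)) : monicCubic A B D = (X - C a) * (X - C b) * (X - C c) := by
  subst hA hB hD
  simp only [monicCubic, map_neg, map_add, map_mul]
  ring

theorem coeff_monicCubic (A B D : ℝ) : (monicCubic A B D).coeff 2 = A ∧
    (monicCubic A B D).coeff 1 = B ∧ (monicCubic A B D).coeff 0 = D := by
  refine ⟨?_, ?_, ?_⟩ <;> simp [monicCubic, coeff_X, coeff_C, coeff_X_pow, -map_add, -map_neg]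

theorem coeffs_of_monicCubic_eq_prod {A B D a b c : ℝ}
    (h : monicCubic A B D = (X - C a) * (X - C b) * (X - C c)) :
    A = -(a + b + c) ∧ B = a * b + b * c + c * a ∧ D = -(a * b * c) := by
  rw [← monicCubic_eq_prod rfl rfl rfl] at h
  refine ⟨?_, ?_, ?_⟩
  · rw [← (coeff_monicCubic A B D).1, h, (coeff_monicCubic _ _ _).1]
  · rw [← (coeff_monicCubic A B D).2.1, h, (coeff_monicCubic _ _ _).2.1]
  · rw [← (coeff_monicCubic A B D).2.2, h, (coeff_monicCubic _ _ _).2.2]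

theorem exists_ordered_roots {A B D : ℝ} (h : (monicCubic A B D).Splits) :
    ∃ a b c : ℝ, a ≤ b ∧ b ≤ c ∧ A = -(a + b + c) ∧ B = a * b + b * c + c * a ∧ D = -(a * b * c) ∧
      monicCubic A B D = (X - C a) * (X - C b) * (X - C c) := by
  have hdeg : (monicCubic A B D).natDegree = 3 := by unfold monicCubic; compute_degree!
  have hmon : (monicCubic A B D).Monic := by unfold monicCubic; monicity!
  have hcard : ((monicCubic A B D).roots.sort (· ≤ ·)).length = 3 := by
    rw [Multiset.length_sort, ← h.natDegree_eq_card_roots, hdeg]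
  obtain ⟨a, b, c, habc⟩ := List.length_eq_three.1 hcard
  have hsorted := Multiset.pairwise_sort (monicCubic A B D).roots (· ≤ ·)
  rw [habc] at hsorted
  have hroots : (monicCubic A B D).roots = ([a, b, c] : Multiset ℝ) := by
    rw [← habc, Multiset.sort_eq]
  have hprod : monicCubic A B D = (X - C a) * (X - C b) * (X - C c) := by
    have := h.eq_prod_roots_of_monic hmon
    rw [this, hroots]
    simp [mul_assoc]
  have hsorted' : (a ≤ b ∧ a ≤ c) ∧ b ≤ c := by simpa using hsorted
  obtain ⟨hA, hB, hD⟩ := coeffs_of_monicCubic_eq_prod hprod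
  exact ⟨a, b, c, hsorted'.1.1, hsorted'.2, hA, hB, hD, hprod⟩

theorem monicCubic_sub_derivative_derivative (A B D : ℝ) :
    monicCubic A B D - derivative (derivative (monicCubic A B D)) =
      monicCubic A (B - 6) (D - 2 * A) := by
  simp only [monicCubic, derivative_add, derivative_mul, derivative_X_pow, derivative_C,
    derivative_X, map_sub, map_mul]
  simp
  have h6 : (C (6 : ℝ) : ℝ[X]) = 6 := rfl
  have h2 : (C (2 : ℝ) : ℝ[X]) = 2 := rfl
  have h3 : (C (3 : ℝ) : ℝ[X]) = 3 := rfl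
  simp only [h6, h2, h3]
  ring

/-! ### Viète's trigonometric formula, used to get joint continuity of the perturbed roots. -/

section VieteFormula

/-- The linear coefficient `-p` of the depressed cubic of `X³ + A X² + B X + D`, with sign changed. -/
noncomputable def depressedP (A B : ℝ) : ℝ := A ^ 2 / 3 - B

/-- The constant coefficient of the depressed cubic of `X³ + A X² + B X + D`. -/
noncomputable def depressedQ (A B D : ℝ) : ℝ := 2 * A ^ 3 / 27 - A * B / 3 + D

/-- The angle in Viète's trigonometric formula. -/
noncomputable def vieteAngle (A B D : ℝ) : ℝ :=
  Real.arccos (-3 * depressedQ A B D / (2 * √(depressedP A B / 3) * depressedP A B)) / 3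

/-- Viète's formula for the roots of a cubic with real roots. -/
noncomputable def vieteRoot (j : Fin 3) (A B D : ℝ) : ℝ :=
  2 * √(depressedP A B / 3) *
    ![-(Real.cos (vieteAngle A B D) + √3 * Real.sin (vieteAngle A B D)) / 2,
      -(Real.cos (vieteAngle A B D) - √3 * Real.sin (vieteAngle A B D)) / 2,
      Real.cos (vieteAngle A B D)] j - A / 3

/-- The triple angle formula turns the depressed cubic into an equation for `cos 3φ`, solvable
because the discriminant is nonnegative. The ordering comes from `φ ∈ [0, π/3]`, where `sin φ ≥ 0`
and `cos φ ≥ 1/2`. -/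
theorem vieteRoot_spec {A B D : ℝ} (hP : 0 < depressedP A B)
    (hQ : 27 * depressedQ A B D ^ 2 ≤ 4 * depressedP A B ^ 3) :
    vieteRoot 0 A B D ≤ vieteRoot 1 A B D ∧ vieteRoot 1 A B D ≤ vieteRoot 2 A B D ∧
      monicCubic A B D = (X - C (vieteRoot 0 A B D)) * (X - C (vieteRoot 1 A B D)) *
        (X - C (vieteRoot 2 A B D)) := by
  set p := depressedP A B with hp
  set q := depressedQ A B D with hq
  set m := √(p / 3) with hm
  set φ := vieteAngle A B D with hφ
  have hm0 : 0 < m := Real.sqrt_pos.2 (by positivity)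
  have hm2 : m ^ 2 = p / 3 := Real.sq_sqrt (by positivity)
  have hden : 0 < 2 * m * p := by positivity
  have habs : |(-3 * q / (2 * m * p))| ≤ 1 := by
    rw [abs_div, abs_of_pos hden, div_le_one hden]
    refine abs_le_of_sq_le_sq ?_ hden.le
    have : (2 * m * p) ^ 2 = 4 * p ^ 3 / 3 := by rw [mul_pow, mul_pow, hm2]; ring
    rw [this]
    linarith
  have hcos3 : Real.cos (3 * φ) = -3 * q / (2 * m * p) := by
    rw [hφ, vieteAngle, mul_div_cancel₀ _ (by norm_num : (3 : ℝ) ≠ 0)]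
    exact Real.cos_arccos (abs_le.1 habs).1 (abs_le.1 habs).2
  have hφ0 : 0 ≤ φ := div_nonneg (Real.arccos_nonneg _) (by norm_num)
  have hφ1 : φ ≤ Real.pi / 3 := div_le_div_of_nonneg_right (Real.arccos_le_pi _) (by norm_num)
  have hsin : 0 ≤ Real.sin φ := Real.sin_nonneg_of_nonneg_of_le_pi hφ0
    (hφ1.trans (by linarith [Real.pi_pos]))
  have hcos : 1 / 2 ≤ Real.cos φ := by
    rw [← Real.cos_pi_div_three]
    exact Real.cos_le_cos_of_nonneg_of_le_pi hφ0 (by linarith [Real.pi_pos]) hφ1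
  have hw0 : 0 ≤ √(3 : ℝ) := Real.sqrt_nonneg _
  have hw2 : √(3 : ℝ) ^ 2 = 3 := Real.sq_sqrt (by norm_num)
  have hsc := Real.sin_sq_add_cos_sq φ
  have hc3 := Real.cos_three_mul φ
  rw [hcos3, div_eq_iff hden.ne'] at hc3
  have e0 : vieteRoot 0 A B D = 2 * m * (-(Real.cos φ + √3 * Real.sin φ) / 2) - A / 3 := rfl
  have e1 : vieteRoot 1 A B D = 2 * m * (-(Real.cos φ - √3 * Real.sin φ) / 2) - A / 3 := rfl
  have e2 : vieteRoot 2 A B D = 2 * m * Real.cos φ - A / 3 := rfl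
  rw [e0, e1, e2]
  generalize Real.cos φ = u at *
  generalize Real.sin φ = v at *
  generalize √(3 : ℝ) = w at *
  have hwv : 0 ≤ w * v := mul_nonneg hw0 hsin
  -- After squaring this is `3 (1 - u²) ≤ 9 u²`, that is, `u ≥ 1/2`.
  have hwvu : w * v ≤ 3 * u := by
    refine abs_le_of_sq_le_sq' ?_ (by linarith) |>.2
    rw [mul_pow, hw2]
    nlinarith
  have hBp : B = A ^ 2 / 3 - p := by rw [hp, depressedP]; ring
  have hDq : D = q - 2 * A ^ 3 / 27 + A * B / 3 := by rw [hq, depressedQ]; ring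
  have hv2 : v ^ 2 = 1 - u ^ 2 := by linarith
  have hpm : p = 3 * m ^ 2 := by linarith
  refine ⟨?_, ?_, monicCubic_eq_prod ?_ ?_ ?_⟩
  · have := mul_nonneg hm0.le hwv
    nlinarith
  · have := mul_nonneg hm0.le (sub_nonneg.2 hwvu)
    nlinarith
  · ring
  · rw [hBp, hpm]
    linear_combination (m ^ 2 * v ^ 2) * hw2 + 3 * m ^ 2 * hv2
  · rw [hDq, hBp]
    have hq' : q = -2 * m ^ 3 * (4 * u ^ 3 - 3 * u) := by
      rw [hpm] at hc3
      linear_combination (-1 / 3 : ℝ) * hc3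
    rw [hq', hpm]
    linear_combination (A / 3 * m ^ 2 * v ^ 2 - 2 * m ^ 3 * u * v ^ 2) * hw2 +
      (A * m ^ 2 - 6 * m ^ 3 * u) * hv2

theorem ContinuousOn.vieteRoot {α : Type*} [TopologicalSpace α] {A B D : α → ℝ} {s : Set α}
    (hA : ContinuousOn A s) (hB : ContinuousOn B s) (hD : ContinuousOn D s)
    (hP : ∀ x ∈ s, 0 < depressedP (A x) (B x)) (j : Fin 3) :
    ContinuousOn (fun x => _root_.vieteRoot j (A x) (B x) (D x)) s := by
  have hp : ContinuousOn (fun x => depressedP (A x) (B x)) s := ((hA.pow 2).div_const 3).sub hB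
  have hq : ContinuousOn (fun x => depressedQ (A x) (B x) (D x)) s :=
    ((((hA.pow 3).const_mul 2).div_const 27).sub ((hA.mul hB).div_const 3)).add hD
  have hm : ContinuousOn (fun x => √(depressedP (A x) (B x) / 3)) s := (hp.div_const 3).sqrt
  have hφ : ContinuousOn (fun x => vieteAngle (A x) (B x) (D x)) s := by
    refine (Real.continuous_arccos.comp_continuousOn
      ((hq.const_mul (-3)).div ((hm.const_mul 2).mul hp) fun x hx => ?_)).div_const 3
    have hx' := hP x hx
    have : 0 < √(depressedP (A x) (B x) / 3) := Real.sqrt_pos.2 (by positivity)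
    exact (mul_pos (mul_pos two_pos this) hx').ne'
  have hc := Real.continuous_cos.comp_continuousOn hφ
  have hs := Real.continuous_sin.comp_continuousOn hφ
  fin_cases j
  · exact ((hm.const_mul 2).mul ((hc.add (hs.const_mul (√3))).neg.div_const 2)).sub (hA.div_const 3)
  · exact ((hm.const_mul 2).mul ((hc.sub (hs.const_mul (√3))).neg.div_const 2)).sub (hA.div_const 3)
  · exact ((hm.const_mul 2).mul hc).sub (hA.div_const 3)

end VieteFormula

/-! ### Separation and displacement of roots under `P ↦ P - P''`. -/

section RootPerturbation

/-- `x ≤ y ≤ z` are the roots of `P - P''`, where `P = (X - a) (X - b) (X - c)`, `a ≤ b ≤ c`. -/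
structure NuijRoots (a b c x y z : ℝ) : Prop where
  ab : a ≤ b
  bc : b ≤ c
  xy : x ≤ y
  yz : y ≤ z
  e1 : x + y + z = a + b + c
  e2 : x * y + y * z + z * x = a * b + b * c + c * a - 6
  e3 : x * y * z = a * b * c - 2 * (a + b + c)

namespace NuijRoots

variable {a b c x y z : ℝ}

theorem eval_eq (h : NuijRoots a b c x y z) (u : ℝ) :
    (u - x) * (u - y) * (u - z) = (u - a) * (u - b) * (u - c) - 2 * (3 * u - a - b - c) := by
  linear_combination (-u ^ 2) * h.e1 + u * h.e2 - h.e3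

/-- The reflection `u ↦ -u` exchanges the first and last roots, so each estimate is proved at one
end only. -/
theorem neg (h : NuijRoots a b c x y z) : NuijRoots (-c) (-b) (-a) (-z) (-y) (-x) where
  ab := neg_le_neg h.bc
  bc := neg_le_neg h.ab
  xy := neg_le_neg h.yz
  yz := neg_le_neg h.xy
  e1 := by linear_combination -h.e1
  e2 := by linear_combination h.e2
  e3 := by linear_combination -h.e3

/-- At `c` the perturbed cubic equals `-P''(c) ≤ 0`, but it is positive to the right of `z`. -/
theorem le_last (h : NuijRoots a b c x y z) : c ≤ z := by
  by_contra! hlt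
  have h1 := h.eval_eq c
  have h2 : 0 < (c - x) * (c - y) * (c - z) := by
    have := h.xy
    have := h.yz
    exact mul_pos (mul_pos (by linarith) (by linarith)) (by linarith)
  have := h.ab
  have := h.bc
  rw [sub_self, mul_zero, zero_sub] at h1
  linarith

/-- More than 3 to the right of all roots of `P`, the cubic `P` dominates `P''`, so `P - P''` has no
zero there. -/
theorem last_le (h : NuijRoots a b c x y z) : z ≤ c + 3 := by
  by_contra! hlt
  have h1 := h.eval_eq z
  have hab := h.ab
  have hbc := h.bc
  have hp : 3 < z - a := by linarith
  have hq : 3 < z - b := by linarith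
  have hr : 3 < z - c := by linarith
  have hpq : 9 < (z - a) * (z - b) := by nlinarith
  have : 9 * (z - c) < (z - a) * (z - b) * (z - c) := by nlinarith
  have hqr : 9 < (z - b) * (z - c) := by nlinarith
  have : 9 * (z - a) < (z - a) * (z - b) * (z - c) := by nlinarith
  rw [sub_self, mul_zero] at h1
  linarith

theorem abs_last_sub_le (h : NuijRoots a b c x y z) : |z - c| ≤ 3 :=
  abs_le.2 ⟨by linarith [h.le_last], by linarith [h.last_le]⟩

theorem abs_first_sub_le (h : NuijRoots a b c x y z) : |x - a| ≤ 3 :=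
  abs_le.2 ⟨by linarith [h.neg.last_le], by linarith [h.neg.le_last]⟩

/-- The sum of the roots is preserved, and the outer roots move outwards, in opposite directions, by
at most 3 each. -/
theorem abs_middle_sub_le (h : NuijRoots a b c x y z) : |y - b| ≤ 3 := by
  have h1 := h.le_last
  have h2 := h.last_le
  have h3 := h.neg.le_last
  have h4 := h.neg.last_le
  have h5 := h.e1
  exact abs_le.2 ⟨by linarith, by linarith⟩

/-- The perturbation raises `e₁² - 3 e₂` from `S` to `Q = S + 18` and fixes the other depressed
invariant, so 27 times the discriminant grows by `4 (Q³ - S³) ≥ 72 Q²`. A gap below 1 would force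
the discriminant to be at most `2 Q²`, and `54 < 72`. -/
theorem one_le_gap (h : NuijRoots a b c x y z) : 1 ≤ y - x := by
  by_contra! hlt
  obtain ⟨g, hg⟩ : ∃ g, g = y - x := ⟨_, rfl⟩
  obtain ⟨k, hk⟩ : ∃ k, k = z - y := ⟨_, rfl⟩
  rw [← hg] at hlt
  have hg0 : 0 ≤ g := hg ▸ sub_nonneg.2 h.xy
  have hk0 : 0 ≤ k := hk ▸ sub_nonneg.2 h.yz
  obtain ⟨Q, hQ⟩ : ∃ Q, Q = g ^ 2 + g * k + k ^ 2 := ⟨_, rfl⟩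
  obtain ⟨S, hS⟩ : ∃ S, S = (b - a) ^ 2 + (b - a) * (c - b) + (c - b) ^ 2 := ⟨_, rfl⟩
  have hS0 : 0 ≤ S := by
    have := mul_nonneg (sub_nonneg.2 h.ab) (sub_nonneg.2 h.bc)
    rw [hS]
    positivity
  have hQS : Q = S + 18 := by
    have e1 : Q = (x + y + z) ^ 2 - 3 * (x * y + y * z + z * x) := by rw [hQ, hg, hk]; ring
    have e2 : S = (a + b + c) ^ 2 - 3 * (a * b + b * c + c * a) := by rw [hS]; ring
    rw [e1, e2, h.e1, h.e2]
    ring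
  have hdisc : 27 * (g * k * (g + k)) ^ 2 =
      27 * ((b - a) * (c - b) * (c - a)) ^ 2 + 4 * (Q ^ 3 - S ^ 3) := by
    have e1 : 27 * (g * k * (g + k)) ^ 2 = 4 * Q ^ 3 - (2 * (x + y + z) ^ 3 -
        9 * (x + y + z) * (x * y + y * z + z * x) + 27 * (x * y * z)) ^ 2 := by
      rw [hQ, hg, hk]; ring
    have e2 : 27 * ((b - a) * (c - b) * (c - a)) ^ 2 = 4 * S ^ 3 - (2 * (a + b + c) ^ 3 -
        9 * (a + b + c) * (a * b + b * c + c * a) + 27 * (a * b * c)) ^ 2 := by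
      rw [hS]; ring
    rw [e1, e2, h.e1, h.e2, h.e3]
    ring
  have hlow : 72 * Q ^ 2 ≤ 27 * (g * k * (g + k)) ^ 2 := by
    have : Q ^ 3 - S ^ 3 = 18 * (Q ^ 2 + Q * S + S ^ 2) := by rw [hQS]; ring
    have h1 : 0 ≤ Q * S := mul_nonneg (by linarith) hS0
    rw [hdisc, this]
    linarith [sq_nonneg ((b - a) * (c - b) * (c - a)), sq_nonneg S]
  have hQ0 : 0 < Q := by linarith
  have hgk := mul_nonneg hg0 hk0
  have h1 : k ^ 2 ≤ Q := by linarith [sq_nonneg g]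
  have h2 : (g + k) ^ 2 ≤ 2 * Q := by rw [hQ, add_sq]; linarith [sq_nonneg g, sq_nonneg k]
  have h3 : k ^ 2 * (g + k) ^ 2 ≤ Q * (2 * Q) :=
    mul_le_mul h1 h2 (sq_nonneg _) hQ0.le
  have h4 : g ^ 2 ≤ 1 := pow_le_one₀ hg0 hlt.le
  have h5 : (g * k * (g + k)) ^ 2 ≤ 1 * (Q * (2 * Q)) := by
    rw [mul_assoc, mul_pow, mul_pow]
    exact mul_le_mul h4 h3 (by positivity) zero_le_one
  have h6 : 0 < Q ^ 2 := by positivity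
  have h7 : 1 * (Q * (2 * Q)) = 2 * Q ^ 2 := by ring
  rw [h7] at h5
  linarith

theorem one_le_gap' (h : NuijRoots a b c x y z) : 1 ≤ z - y := by
  have := h.neg.one_le_gap
  linarith

end NuijRoots

end RootPerturbation

/-! ### Lagrange interpolation: comparing node quotients at two sets of nodes. -/

section Interpolation

theorem quadratic_lagrange (e₀ e₁ e₂ : ℂ) {a b c : ℝ} (hab : a ≠ b) (hbc : b ≠ c) (hca : c ≠ a)
    (x : ℝ) :
    e₀ + e₁ * x + e₂ * x ^ 2 =
      (e₀ + e₁ * a + e₂ * a ^ 2) / ((a - b) * (a - c)) * ((x - b) * (x - c)) +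
      (e₀ + e₁ * b + e₂ * b ^ 2) / ((b - c) * (b - a)) * ((x - c) * (x - a)) +
      (e₀ + e₁ * c + e₂ * c ^ 2) / ((c - a) * (c - b)) * ((x - a) * (x - b)) := by
  have h1 : (a : ℂ) - b ≠ 0 := sub_ne_zero.2 (by exact_mod_cast hab)
  have h2 : (b : ℂ) - c ≠ 0 := sub_ne_zero.2 (by exact_mod_cast hbc)
  have h3 : (c : ℂ) - a ≠ 0 := sub_ne_zero.2 (by exact_mod_cast hca)
  have h1' : (b : ℂ) - a ≠ 0 := by rw [← neg_sub]; exact neg_ne_zero.2 h1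
  have h2' : (c : ℂ) - b ≠ 0 := by rw [← neg_sub]; exact neg_ne_zero.2 h2
  have h3' : (a : ℂ) - c ≠ 0 := by rw [← neg_sub]; exact neg_ne_zero.2 h3
  field_simp
  ring

/-- The quotient `|N(x)| / (|x - y| |x - z|)` for a quadratic polynomial `N`. -/
noncomputable def nodeQuotient (N : ℝ → ℂ) (x y z : ℝ) : ℝ := ‖N x‖ / (|x - y| * |x - z|)

theorem nodeQuotient_nonneg (N : ℝ → ℂ) (x y z : ℝ) : 0 ≤ nodeQuotient N x y z := by
  unfold nodeQuotient; positivity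

/-- Each perturbed node is within 3 of its original and at least 1 from `x`, so `|x - b| ≤ |x - y| +
3 ≤ 4 |x - y|`, and likewise for the others. Every Lagrange basis product is thus at most 16 times
the denominator. -/
theorem nodeQuotient_le {N : ℝ → ℂ} {e₀ e₁ e₂ : ℂ}
    (hN : ∀ x : ℝ, N x = e₀ + e₁ * x + e₂ * x ^ 2) {a b c x y z : ℝ}
    (hab : a ≠ b) (hbc : b ≠ c) (hca : c ≠ a) (hxy : 1 ≤ |x - y|) (hxz : 1 ≤ |x - z|)
    (hxa : |x - a| ≤ 3) (hyb : |y - b| ≤ 3) (hzc : |z - c| ≤ 3) :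
    nodeQuotient N x y z ≤
      16 * (nodeQuotient N a b c + nodeQuotient N b c a + nodeQuotient N c a b) := by
  have hxb : |x - b| ≤ 4 * |x - y| := by
    have := abs_sub_le x y b
    linarith
  have hxc : |x - c| ≤ 4 * |x - z| := by
    have := abs_sub_le x z c
    linarith
  have hpos : 0 < |x - y| * |x - z| := by positivity
  have hval : N x = N a / ((a - b) * (a - c)) * ((x - b) * (x - c)) +
      N b / ((b - c) * (b - a)) * ((x - c) * (x - a)) +
      N c / ((c - a) * (c - b)) * ((x - a) * (x - b)) := by
    rw [hN x, hN a, hN b, hN c]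
    exact quadratic_lagrange e₀ e₁ e₂ hab hbc hca x
  have hnorm : ∀ p q r s t : ℝ, ‖N p / ((p - q) * (p - r)) * ((x - s) * (x - t))‖ =
      nodeQuotient N p q r * (|x - s| * |x - t|) := by
    intro p q r s t
    simp only [← Complex.ofReal_sub, norm_mul, norm_div, Complex.norm_real, Real.norm_eq_abs]
    rfl
  have b1 : |x - b| * |x - c| ≤ 16 * (|x - y| * |x - z|) := by
    calc |x - b| * |x - c| ≤ (4 * |x - y|) * (4 * |x - z|) := by gcongr
      _ = _ := by ring
  have b2 : |x - c| * |x - a| ≤ 16 * (|x - y| * |x - z|) := by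
    calc |x - c| * |x - a| ≤ (4 * |x - z|) * (4 * |x - y|) := by
          gcongr; linarith
      _ = _ := by ring
  have b3 : |x - a| * |x - b| ≤ 16 * (|x - y| * |x - z|) := by
    calc |x - a| * |x - b| ≤ (4 * |x - z|) * (4 * |x - y|) := by
          gcongr; linarith
      _ = _ := by ring
  rw [nodeQuotient, div_le_iff₀ hpos, hval]
  refine (norm_add₃_le).trans ?_
  rw [hnorm, hnorm, hnorm]
  have n1 := mul_le_mul_of_nonneg_left b1 (nodeQuotient_nonneg N a b c)
  have n2 := mul_le_mul_of_nonneg_left b2 (nodeQuotient_nonneg N b c a)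
  have n3 := mul_le_mul_of_nonneg_left b3 (nodeQuotient_nonneg N c a b)
  linarith

end Interpolation

/-! ### Viète's formula applied to the perturbed cubic. -/

section NuijViete

theorem depressedP_nonneg {A B a b c : ℝ} (hA : A = -(a + b + c))
    (hB : B = a * b + b * c + c * a) : 0 ≤ depressedP A B := by
  have : depressedP A B = ((a - b) ^ 2 + (b - c) ^ 2 + (c - a) ^ 2) / 6 := by
    rw [hA, hB, depressedP]; ring
  rw [this]
  positivity

theorem depressed_discr {A B D a b c : ℝ} (hA : A = -(a + b + c)) (hB : B = a * b + b * c + c * a)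
    (hD : D = -(a * b * c)) :
    27 * depressedQ A B D ^ 2 ≤ 4 * depressedP A B ^ 3 := by
  have : 4 * depressedP A B ^ 3 - 27 * depressedQ A B D ^ 2 =
      ((a - b) * (b - c) * (c - a)) ^ 2 := by
    rw [hA, hB, hD, depressedP, depressedQ]; ring
  linarith [sq_nonneg ((a - b) * (b - c) * (c - a))]

/-- The perturbation adds 6 to `depressedP` and leaves `depressedQ` unchanged, so `vieteRoot_spec`
applies even when the original roots all coincide. -/
theorem nuijRoots_vieteRoot {A B D a b c : ℝ} (hab : a ≤ b) (hbc : b ≤ c) (hA : A = -(a + b + c))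
    (hB : B = a * b + b * c + c * a) (hD : D = -(a * b * c)) :
    NuijRoots a b c (vieteRoot 0 A (B - 6) (D - 2 * A)) (vieteRoot 1 A (B - 6) (D - 2 * A))
      (vieteRoot 2 A (B - 6) (D - 2 * A)) ∧
    monicCubic A (B - 6) (D - 2 * A) = (X - C (vieteRoot 0 A (B - 6) (D - 2 * A))) *
      (X - C (vieteRoot 1 A (B - 6) (D - 2 * A))) * (X - C (vieteRoot 2 A (B - 6) (D - 2 * A))) := by
  have hP0 := depressedP_nonneg hA hB
  have hP : depressedP A (B - 6) = depressedP A B + 6 := by unfold depressedP; ring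
  have hQ : depressedQ A (B - 6) (D - 2 * A) = depressedQ A B D := by unfold depressedQ; ring
  obtain ⟨h1, h2, h3⟩ := vieteRoot_spec (A := A) (B := B - 6) (D := D - 2 * A)
    (by rw [hP]; positivity) (by
      rw [hP, hQ]
      refine (depressed_discr hA hB hD).trans ?_
      gcongr
      linarith)
  obtain ⟨e1, e2, e3⟩ := coeffs_of_monicCubic_eq_prod h3
  exact ⟨⟨hab, hbc, h1, h2, by linarith, by linarith, by linarith⟩, h3⟩

end NuijViete

/-! ### Uniform bounds over a finite dimensional space of analytic functions. -/

section FiniteFamily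

open Filter Topology

variable {ι : Type*} [Fintype ι]

/-- The `k`-th derivative of the linear combination `∑ c i h i`. -/
noncomputable def combDeriv (h : ι → ℝ → ℝ) (c : EuclideanSpace ℝ ι) (k : ℕ) (t : ℝ) : ℝ :=
  ∑ i, c i * deriv^[k] (h i) t

theorem isDerivTower_combDeriv {h : ι → ℝ → ℝ} {s : Set ℝ} (hh : ∀ i, AnalyticOnNhd ℝ (h i) s)
    (c : EuclideanSpace ℝ ι) : IsDerivTower (combDeriv h c) s := by
  intro k t ht
  refine HasDerivAt.fun_sum fun i _ => ?_
  rw [Function.iterate_succ_apply']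
  exact ((hh i t ht).iterated_deriv k).differentiableAt.hasDerivAt.const_mul (c i)

theorem continuousAt_combDeriv {h : ι → ℝ → ℝ} {t₀ : ℝ} (hh : ∀ i, AnalyticAt ℝ (h i) t₀)
    (c₀ : EuclideanSpace ℝ ι) (k : ℕ) :
    ContinuousAt (fun p : EuclideanSpace ℝ ι × ℝ => combDeriv h p.1 k p.2) (c₀, t₀) := by
  refine tendsto_finsetSum _ fun i _ => ?_
  refine ContinuousAt.mul (by fun_prop) ?_
  exact ContinuousAt.comp (f := Prod.snd) (x := (c₀, t₀))
    ((hh i).iterated_deriv k).continuousAt continuousAt_snd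

theorem analyticAt_combDeriv {h : ι → ℝ → ℝ} {t₀ : ℝ} (hh : ∀ i, AnalyticAt ℝ (h i) t₀)
    (c : EuclideanSpace ℝ ι) (k : ℕ) : AnalyticAt ℝ (combDeriv h c k) t₀ :=
  Finset.analyticAt_fun_sum _ fun i _ => analyticAt_const.mul ((hh i).iterated_deriv k)

theorem iteratedDeriv_combDeriv {h : ι → ℝ → ℝ} {t₀ : ℝ} (hh : ∀ i, AnalyticAt ℝ (h i) t₀)
    (c : EuclideanSpace ℝ ι) (k m : ℕ) :
    iteratedDeriv m (combDeriv h c k) t₀ = combDeriv h c (m + k) t₀ := by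
  have hc : ∀ i, ContDiffAt ℝ m (deriv^[k] (h i)) t₀ := fun i =>
    ((hh i).iterated_deriv k).contDiffAt
  unfold combDeriv
  rw [iteratedDeriv_fun_sum fun i _ => contDiffAt_const.mul (hc i)]
  refine Finset.sum_congr rfl fun i _ => ?_
  rw [iteratedDeriv_const_mul_field, iteratedDeriv_eq_iterate, Function.iterate_add_apply]

/-- Identity theorem: infinite order of vanishing at one point of the connected interval forces
vanishing throughout. -/
theorem combDeriv_eq_zero_of_forall {h : ι → ℝ → ℝ} {T t₀ : ℝ}
    (hh : ∀ i, AnalyticOnNhd ℝ (h i) (Icc 0 T)) (ht₀ : t₀ ∈ Icc 0 T) {c : EuclideanSpace ℝ ι}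
    (h0 : ∀ m, combDeriv h c m t₀ = 0) (k : ℕ) {t : ℝ} (ht : t ∈ Icc 0 T) :
    combDeriv h c k t = 0 := by
  have han : AnalyticOnNhd ℝ (combDeriv h c k) (Icc 0 T) := fun s hs =>
    analyticAt_combDeriv (fun i => hh i s hs) c k
  refine han.eqOn_zero_of_preconnected_of_eventuallyEq_zero isPreconnected_Icc ht₀
    (analyticOrderAt_eq_top.1 ?_) ht
  rw [ENat.eq_top_iff_forall_ge]
  intro m
  rw [natCast_le_analyticOrderAt_iff_iteratedDeriv_eq_zero (han t₀ ht₀)]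
  intro i _
  rw [iteratedDeriv_combDeriv fun i => hh i t₀ ht₀]
  exact h0 _

/-- The logarithmic bound for truncated logarithmic derivatives of `∑ c i h i` on `S`. -/
def LogDerivBound (h : ι → ℝ → ℝ) (T : ℝ) (c : EuclideanSpace ℝ ι) (S : Set ℝ) (K : ℝ) : Prop :=
  (∀ t ∈ Icc 0 T, 0 ≤ combDeriv h c 0 t) → ∀ (R : ℝ) (u : ℝ → ℝ), 2 ≤ R →
    (∀ t ∈ Icc 0 T, u t ≤ R) →
    (∀ t ∈ Icc 0 T, u t * combDeriv h c 0 t ≤ |combDeriv h c 1 t|) →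
    ∫⁻ t in S ∩ Icc 0 T, ENNReal.ofReal (u t) ≤ ENNReal.ofReal (K * Real.log R)

theorem LogDerivBound.mono {h : ι → ℝ → ℝ} {T : ℝ} {c : EuclideanSpace ℝ ι} {S S' : Set ℝ} {K : ℝ}
    (hb : LogDerivBound h T c S K) (hS : S' ⊆ S) : LogDerivBound h T c S' K :=
  fun h0 R u hR h1 h2 =>
    (lintegral_mono_set (inter_subset_inter_left _ hS)).trans (hb h0 R u hR h1 h2)

theorem LogDerivBound.union {h : ι → ℝ → ℝ} {T : ℝ} {c : EuclideanSpace ℝ ι} {S S' : Set ℝ}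
    {K K' : ℝ} (hK : 0 ≤ K) (hK' : 0 ≤ K') (hb : LogDerivBound h T c S K)
    (hb' : LogDerivBound h T c S' K') : LogDerivBound h T c (S ∪ S') (K + K') := by
  intro h0 R u hR h1 h2
  have hl : 0 ≤ Real.log R := Real.log_nonneg (by linarith)
  rw [union_inter_distrib_right, add_mul, ENNReal.ofReal_add (by positivity) (by positivity)]
  exact (lintegral_union_le _ _ _).trans
    (add_le_add (hb h0 R u hR h1 h2) (hb' h0 R u hR h1 h2))

theorem LogDerivBound.weaken {h : ι → ℝ → ℝ} {T : ℝ} {c : EuclideanSpace ℝ ι} {S : Set ℝ}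
    {K K' : ℝ} (hK : K ≤ K') (hb : LogDerivBound h T c S K) : LogDerivBound h T c S K' :=
  fun h0 R u hR h1 h2 => (hb h0 R u hR h1 h2).trans <| ENNReal.ofReal_le_ofReal <|
    mul_le_mul_of_nonneg_right hK (Real.log_nonneg (by linarith))

/-- By joint continuity, a derivative nonzero at `(c₀, t₀)` stays away from zero, with fixed sign,
on a whole box. The one-variable estimate then has the same constants for all `c` near `c₀`. -/
theorem exists_logDerivBound_local {h : ι → ℝ → ℝ} {T t₀ : ℝ}
    (hh : ∀ i, AnalyticOnNhd ℝ (h i) (Icc 0 T)) (ht₀ : t₀ ∈ Icc 0 T) {c₀ : EuclideanSpace ℝ ι}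
    {m : ℕ} (hm : combDeriv h c₀ m t₀ ≠ 0) :
    ∃ K : ℝ, 0 < K ∧ ∃ V ∈ 𝓝 t₀, ∀ᶠ c in 𝓝 c₀, LogDerivBound h T c V K := by
  have hcont := continuousAt_combDeriv (fun i => hh i t₀ ht₀) c₀
  set κ : ℝ := |combDeriv h c₀ m t₀| / 2 with hκ
  have hκ0 : 0 < κ := half_pos (abs_pos.2 hm)
  set S : ℝ := |combDeriv h c₀ 0 t₀| + 1
  set S' : ℝ := |combDeriv h c₀ 1 t₀| + 1 with hS'
  have hS'0 : 0 < S' := by positivity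
  have ev1 : ∀ᶠ p : EuclideanSpace ℝ ι × ℝ in 𝓝 c₀ ×ˢ 𝓝 t₀, |combDeriv h p.1 0 p.2| < S := by
    rw [← nhds_prod_eq]
    exact (hcont 0).abs.eventually_lt_const (lt_add_one _)
  have ev2 : ∀ᶠ p : EuclideanSpace ℝ ι × ℝ in 𝓝 c₀ ×ˢ 𝓝 t₀, |combDeriv h p.1 1 p.2| < S' := by
    rw [← nhds_prod_eq]
    exact (hcont 1).abs.eventually_lt_const (lt_add_one _)
  have ev3 : (∀ᶠ p : EuclideanSpace ℝ ι × ℝ in 𝓝 c₀ ×ˢ 𝓝 t₀, κ < combDeriv h p.1 m p.2) ∨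
      ∀ᶠ p : EuclideanSpace ℝ ι × ℝ in 𝓝 c₀ ×ˢ 𝓝 t₀, combDeriv h p.1 m p.2 < -κ := by
    rw [← nhds_prod_eq]
    rcases lt_or_gt_of_ne hm with hlt | hgt
    · right
      refine (hcont m).eventually_lt_const ?_
      rw [hκ, abs_of_neg hlt]
      simp only
      linarith
    · left
      refine (hcont m).eventually_const_lt ?_
      rw [hκ, abs_of_pos hgt]
      simp only
      linarith
  have box : ∀ q : EuclideanSpace ℝ ι × ℝ → Prop, (∀ᶠ p in 𝓝 c₀ ×ˢ 𝓝 t₀, q p) →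
      ∃ δ > 0, ∀ᶠ c in 𝓝 c₀, ∀ t ∈ Icc (t₀ - δ) (t₀ + δ), q (c, t) := by
    intro q hq
    obtain ⟨pa, hpa, pb, hpb, H⟩ := eventually_prod_iff.1 hq
    obtain ⟨δ, hδ, hball⟩ := Metric.nhds_basis_closedBall.eventually_iff.1 hpb
    refine ⟨δ, hδ, hpa.mono fun c hc t ht => H hc (hball ?_)⟩
    rwa [Real.closedBall_eq_Icc]
  have inter : ∀ δ > 0, ∃ a b, a ≤ b ∧ b - a ≤ T ∧
      Icc (t₀ - δ) (t₀ + δ) ∩ Icc 0 T = Icc a b := by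
    intro δ hδ
    refine ⟨max (t₀ - δ) 0, min (t₀ + δ) T, ?_, ?_, Icc_inter_Icc⟩
    · exact max_le (le_min (by linarith) (by linarith [ht₀.2]))
        (le_min (by linarith [ht₀.1]) (ht₀.1.trans ht₀.2))
    · linarith [min_le_right (t₀ + δ) T, le_max_right (t₀ - δ) 0]
  have hl2 : 0 < Real.log 2 := Real.log_pos one_lt_two
  have hT : 0 ≤ T := ht₀.1.trans ht₀.2
  have finish : ∀ q : EuclideanSpace ℝ ι × ℝ → Prop, (∀ᶠ p in 𝓝 c₀ ×ˢ 𝓝 t₀, q p) →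
      ∀ K, 0 < K → (∀ a b, a ≤ b → b - a ≤ T → Icc a b ⊆ Icc 0 T → ∀ c : EuclideanSpace ℝ ι,
        (∀ t ∈ Icc a b, q (c, t)) → LogDerivBound h T c (Icc a b) K) →
      ∃ K : ℝ, 0 < K ∧ ∃ V ∈ 𝓝 t₀, ∀ᶠ c in 𝓝 c₀, LogDerivBound h T c V K := by
    intro q hq K hK H
    obtain ⟨δ, hδ, hev⟩ := box q hq
    refine ⟨K, hK, Icc (t₀ - δ) (t₀ + δ), Icc_mem_nhds (by linarith) (by linarith),
      hev.mono fun c hc => ?_⟩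
    obtain ⟨a, b, hab, hbT, hI⟩ := inter δ hδ
    have hsub : Icc a b ⊆ Icc 0 T := hI ▸ inter_subset_right
    have := H a b hab hbT hsub c fun t ht => hc t (by rw [← hI] at ht; exact ht.1)
    intro h0 R u hR h1 h2
    have := this h0 R u hR h1 h2
    rwa [inter_eq_self_of_subset_left hsub, ← hI] at this
  rcases m with _ | m
  -- For `m = 0` the function itself is bounded below, so `u ≤ S' / κ` without any use of the
  -- truncation.
  · have hpos : ∀ᶠ p : EuclideanSpace ℝ ι × ℝ in 𝓝 c₀ ×ˢ 𝓝 t₀, κ < |combDeriv h p.1 0 p.2| := by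
      rcases ev3 with ev | ev
      · exact ev.mono fun p hp => hp.trans_le (le_abs_self _)
      · exact ev.mono fun p hp => (lt_neg.1 hp).trans_le (neg_le_abs _)
    refine finish _ (hpos.and ev2) (S' / κ * (T + 1) / Real.log 2) (by positivity) ?_
    intro a b hab hbT hsub c hc h0 R u hR _ hu
    rw [inter_eq_self_of_subset_left hsub]
    have hle : ∀ t ∈ Icc a b, u t ≤ S' / κ := by
      intro t ht
      rcases le_total (u t) 0 with hu0 | hu0
      · exact hu0.trans (by positivity)
      rw [le_div_iff₀ hκ0]
      have hc1 := (hc t ht).1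
      rw [abs_of_nonneg (h0 t (hsub ht))] at hc1
      exact (mul_le_mul_of_nonneg_left hc1.le hu0).trans ((hu t (hsub ht)).trans (hc t ht).2.le)
    refine (lintegral_Icc_le_of_le (by positivity) hle).trans (ENNReal.ofReal_le_ofReal ?_)
    rw [div_mul_eq_mul_div (S' / κ * (T + 1)) (Real.log 2), le_div_iff₀ hl2]
    have hlog : Real.log 2 ≤ Real.log R := Real.log_le_log two_pos hR
    have : S' / κ * (b - a) ≤ S' / κ * (T + 1) :=
      mul_le_mul_of_nonneg_left (by linarith) (by positivity)
    exact mul_le_mul this hlog hl2.le (by positivity)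
  · obtain ⟨K, hK, H⟩ := exists_lintegral_le_log_of_iterated m (S := S) hκ0
    have main : ∀ a b, a ≤ b → Icc a b ⊆ Icc 0 T → ∀ c : EuclideanSpace ℝ ι,
        ((∀ t ∈ Icc a b, κ ≤ combDeriv h c (m + 1) t) ∨
          ∀ t ∈ Icc a b, combDeriv h c (m + 1) t ≤ -κ) →
        (∀ t ∈ Icc a b, |combDeriv h c 0 t| < S) → LogDerivBound h T c (Icc a b) K := by
      intro a b hab hsub c hs hb h0 R u hR h1 h2
      rw [inter_eq_self_of_subset_left hsub]
      exact H (combDeriv h c) a b hab ((isDerivTower_combDeriv hh c).mono hsub) hs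
        (fun t ht => ⟨h0 t (hsub ht), (le_abs_self _).trans (hb t ht).le⟩) R u hR
        (fun t ht => h1 t (hsub ht)) fun t ht => h2 t (hsub ht)
    rcases ev3 with ev | ev
    · exact finish _ (ev.and ev1) K hK fun a b hab _ hsub c hc =>
        main a b hab hsub c (Or.inl fun t ht => (hc t ht).1.le) fun t ht => (hc t ht).2
    · exact finish _ (ev.and ev1) K hK fun a b hab _ hsub c hc =>
        main a b hab hsub c (Or.inr fun t ht => (hc t ht).1.le) fun t ht => (hc t ht).2

/-- The coefficient vectors `c` for which `∑ c i h i` vanishes on `[0,T]` with all derivatives. -/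
def combKer (h : ι → ℝ → ℝ) (T : ℝ) : Submodule ℝ (EuclideanSpace ℝ ι) where
  carrier := {c | ∀ k, ∀ t ∈ Icc 0 T, combDeriv h c k t = 0}
  add_mem' := fun {a b} ha hb k t ht => by
    have : combDeriv h (a + b) k t = combDeriv h a k t + combDeriv h b k t := by
      simp [combDeriv, add_mul, Finset.sum_add_distrib]
    rw [this, ha k t ht, hb k t ht, add_zero]
  zero_mem' := fun k t _ => by simp [combDeriv]
  smul_mem' := fun r a ha k t ht => by
    have : combDeriv h (r • a) k t = r * combDeriv h a k t := by
      simp [combDeriv, mul_assoc, Finset.mul_sum]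
    rw [this, ha k t ht, mul_zero]

/-- Outside the kernel some derivative is nonzero at every point of `[0,T]`; finitely many local
boxes cover the interval and their constants add up. -/
theorem exists_logDerivBound_nhds {h : ι → ℝ → ℝ} {T : ℝ}
    (hh : ∀ i, AnalyticOnNhd ℝ (h i) (Icc 0 T)) {c₀ : EuclideanSpace ℝ ι}
    (hc₀ : c₀ ∉ combKer h T) :
    ∃ K : ℝ, 0 < K ∧ ∀ᶠ c in 𝓝 c₀, LogDerivBound h T c (Icc 0 T) K := by
  refine (isCompact_Icc (a := (0 : ℝ)) (b := T)).induction_on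
    (p := fun S => ∃ K : ℝ, 0 < K ∧ ∀ᶠ c in 𝓝 c₀, LogDerivBound h T c S K) ?_ ?_ ?_ ?_
  · exact ⟨1, one_pos, Eventually.of_forall fun c h0 R u hR h1 h2 => by simp⟩
  · rintro S S' hS ⟨K, hK, hev⟩
    exact ⟨K, hK, hev.mono fun c hc => hc.mono hS⟩
  · rintro S S' ⟨K, hK, hev⟩ ⟨K', hK', hev'⟩
    refine ⟨K + K', by positivity, ?_⟩
    filter_upwards [hev, hev'] with c hc hc'
    exact hc.union hK.le hK'.le hc'
  · intro t₀ ht₀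
    have : ∃ m, combDeriv h c₀ m t₀ ≠ 0 := by
      by_contra! hall
      exact hc₀ fun k t ht => combDeriv_eq_zero_of_forall hh ht₀ hall k ht
    obtain ⟨m, hm⟩ := this
    obtain ⟨K, hK, V, hV, hev⟩ := exists_logDerivBound_local hh ht₀ hm
    exact ⟨V, mem_nhdsWithin_of_mem_nhds hV, K, hK, hev⟩

/-- Uniform logarithmic bound: in a finite dimensional space of analytic functions on `[0,T]`, the
logarithmic derivative of a nonnegative nonzero element, truncated at `R`, has integral at most
`K log R` with `K` depending only on the space. -/
theorem exists_uniform_logDerivBound {h : ι → ℝ → ℝ} {T : ℝ}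
    (hh : ∀ i, AnalyticOnNhd ℝ (h i) (Icc 0 T)) :
    ∃ K : ℝ, 0 < K ∧ ∀ c ∉ combKer h T, LogDerivBound h T c (Icc 0 T) K := by
  set Z : Set (EuclideanSpace ℝ ι) := Metric.sphere 0 1 ∩ (combKer h T)ᗮ with hZ
  have hZc : IsCompact Z := (isCompact_sphere 0 1).inter_right (Submodule.isClosed_orthogonal _)
  have hcomp : ∃ K : ℝ, 0 < K ∧ ∀ c ∈ Z, LogDerivBound h T c (Icc 0 T) K := by
    refine hZc.induction_on
      (p := fun S => ∃ K : ℝ, 0 < K ∧ ∀ c ∈ S, LogDerivBound h T c (Icc 0 T) K) ?_ ?_ ?_ ?_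
    · exact ⟨1, one_pos, by simp⟩
    · rintro S S' hS ⟨K, hK, H⟩
      exact ⟨K, hK, fun c hc => H c (hS hc)⟩
    · rintro S S' ⟨K, hK, H⟩ ⟨K', hK', H'⟩
      refine ⟨max K K', lt_max_of_lt_left hK, ?_⟩
      rintro c (hc | hc)
      · exact (H c hc).weaken (le_max_left _ _)
      · exact (H' c hc).weaken (le_max_right _ _)
    · intro c₀ hc₀
      have hker : c₀ ∉ combKer h T := by
        intro hmem
        have h0 : c₀ = 0 := by
          have := hc₀.2 c₀ hmem
          rwa [inner_self_eq_zero] at this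
        have h1 := hc₀.1
        rw [h0] at h1
        simp at h1
      obtain ⟨K, hK, hev⟩ := exists_logDerivBound_nhds hh hker
      exact ⟨_, mem_nhdsWithin_of_mem_nhds hev, K, hK, fun c hc => hc⟩
  obtain ⟨K, hK, H⟩ := hcomp
  refine ⟨K, hK, fun c hc => ?_⟩
  -- The kernel component contributes nothing on `[0,T]`, and the inequality `u f ≤ |f'|` is
  -- invariant under positive scaling, so `c` may be replaced by a unit vector of `Z`.
  obtain ⟨v, hv, w, hw, hcvw⟩ := (combKer h T).exists_add_mem_mem_orthogonal c
  have hw0 : w ≠ 0 := by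
    rintro rfl
    rw [add_zero] at hcvw
    exact hc (hcvw ▸ hv)
  have hn : 0 < ‖w‖ := norm_pos_iff.2 hw0
  have hz : ‖w‖⁻¹ • w ∈ Z := by
    refine ⟨?_, Submodule.smul_mem _ _ hw⟩
    rw [mem_sphere_zero_iff_norm, norm_smul, norm_inv, norm_norm, inv_mul_cancel₀ hn.ne']
  have hval : ∀ k, ∀ t ∈ Icc 0 T, combDeriv h (‖w‖⁻¹ • w) k t = ‖w‖⁻¹ * combDeriv h c k t := by
    intro k t ht
    have h1 : combDeriv h c k t = combDeriv h v k t + combDeriv h w k t := by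
      rw [hcvw]
      simp [combDeriv, add_mul, Finset.sum_add_distrib]
    rw [h1, hv k t ht, zero_add]
    simp [combDeriv, mul_assoc, Finset.mul_sum]
  intro h0 R u hR h1 h2
  refine H _ hz (fun t ht => ?_) R u hR h1 fun t ht => ?_
  · rw [hval 0 t ht]
    exact mul_nonneg (by positivity) (h0 t ht)
  · rw [hval 0 t ht, hval 1 t ht, abs_mul, abs_of_pos (inv_pos.2 hn), mul_left_comm]
    exact mul_le_mul_of_nonneg_left (h2 t ht) (by positivity)

end FiniteFamily

/-! ### Symbols: continuity, polynomial growth in `ξ`, separation of variables. -/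

section MonomialSum

variable {n : ℕ} {F : Type*} [NormedAddCommGroup F] [NormedSpace ℝ F]

/-- The homogeneous symbol `∑_{α ∈ S} f_α(t) ξ^α`. -/
noncomputable def monomialSum (S : Finset (Fin n → ℕ)) (f : (Fin n → ℕ) → ℝ → F) (t : ℝ)
    (ξ : EuclideanSpace ℝ (Fin n)) : F :=
  ∑ α ∈ S, (∏ i, ξ i ^ α i) • f α t

theorem continuousOn_monomialSum {S : Finset (Fin n → ℕ)} {f : (Fin n → ℕ) → ℝ → F} {I : Set ℝ}
    (hf : ∀ α ∈ S, ContinuousOn (f α) I) :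
    ContinuousOn (fun p : ℝ × EuclideanSpace ℝ (Fin n) => monomialSum S f p.1 p.2)
      (I ×ˢ univ) := by
  refine continuousOn_finsetSum _ fun α hα => ?_
  refine ContinuousOn.smul (by fun_prop) ?_
  exact (hf α hα).comp continuousOn_fst fun p hp => hp.1

theorem hasDerivAt_monomialSum {S : Finset (Fin n → ℕ)} {f : (Fin n → ℕ) → ℝ → F} {t : ℝ}
    (hf : ∀ α ∈ S, DifferentiableAt ℝ (f α) t) (ξ : EuclideanSpace ℝ (Fin n)) :
    HasDerivAt (fun s => monomialSum S f s ξ) (monomialSum S (fun α => deriv (f α)) t ξ) t :=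
  HasDerivAt.fun_sum fun α hα => ((hf α hα).hasDerivAt).const_smul _

theorem analyticAt_monomialSum_line (S : Finset (Fin n → ℕ)) (f : (Fin n → ℕ) → ℝ → ℝ) (t : ℝ)
    (ξ η : EuclideanSpace ℝ (Fin n)) (s : ℝ) :
    AnalyticAt ℝ (fun s : ℝ => monomialSum S f t (ξ + s • η)) s := by
  unfold monomialSum
  simp only [PiLp.add_apply, PiLp.smul_apply, smul_eq_mul]
  fun_prop

theorem abs_prod_pow_le (ξ : EuclideanSpace ℝ (Fin n)) (α : Fin n → ℕ) :
    |∏ i, ξ i ^ α i| ≤ (1 + ‖ξ‖) ^ ∑ i, α i := by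
  rw [Finset.abs_prod, ← Finset.prod_pow_eq_pow_sum]
  refine Finset.prod_le_prod (fun i _ => abs_nonneg _) fun i _ => ?_
  rw [abs_pow]
  have h1 : |ξ i| ≤ ‖ξ‖ := PiLp.norm_apply_le ξ i
  exact pow_le_pow_left₀ (abs_nonneg _) (by linarith) _

end MonomialSum

section PolyBounded

variable {n : ℕ}

/-- `G(t,ξ)` grows at most polynomially in `ξ`, uniformly in `t ∈ [0,T]`. -/
def PolyBounded (T : ℝ) (G : ℝ → EuclideanSpace ℝ (Fin n) → ℝ) : Prop :=
  ∃ (K : ℝ) (N : ℕ), 0 ≤ K ∧ ∀ t ∈ Icc 0 T, ∀ ξ, |G t ξ| ≤ K * (1 + ‖ξ‖) ^ N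

namespace PolyBounded

variable {T : ℝ} {G H : ℝ → EuclideanSpace ℝ (Fin n) → ℝ}

theorem const (c : ℝ) : PolyBounded T (fun _ (_ : EuclideanSpace ℝ (Fin n)) => c) :=
  ⟨|c|, 0, abs_nonneg c, fun t _ ξ => by simp⟩

theorem mono (hG : PolyBounded T G) (h : ∀ t ∈ Icc 0 T, ∀ ξ, |H t ξ| ≤ |G t ξ|) :
    PolyBounded T H := by
  obtain ⟨K, N, hK, hb⟩ := hG
  exact ⟨K, N, hK, fun t ht ξ => (h t ht ξ).trans (hb t ht ξ)⟩

theorem add (hG : PolyBounded T G) (hH : PolyBounded T H) :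
    PolyBounded T (fun t ξ => G t ξ + H t ξ) := by
  obtain ⟨K, N, hK, hb⟩ := hG
  obtain ⟨K', N', hK', hb'⟩ := hH
  refine ⟨K + K', max N N', by positivity, fun t ht ξ => (abs_add_le _ _).trans ?_⟩
  have h1 : 1 ≤ 1 + ‖ξ‖ := by linarith [norm_nonneg ξ]
  rw [add_mul]
  refine add_le_add ((hb t ht ξ).trans ?_) ((hb' t ht ξ).trans ?_)
  · exact mul_le_mul_of_nonneg_left (pow_le_pow_right₀ h1 (le_max_left _ _)) hK
  · exact mul_le_mul_of_nonneg_left (pow_le_pow_right₀ h1 (le_max_right _ _)) hK'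

theorem mul (hG : PolyBounded T G) (hH : PolyBounded T H) :
    PolyBounded T (fun t ξ => G t ξ * H t ξ) := by
  obtain ⟨K, N, hK, hb⟩ := hG
  obtain ⟨K', N', hK', hb'⟩ := hH
  refine ⟨K * K', N + N', by positivity, fun t ht ξ => ?_⟩
  rw [abs_mul, pow_add, mul_mul_mul_comm]
  exact mul_le_mul (hb t ht ξ) (hb' t ht ξ) (abs_nonneg _)
    (by have := norm_nonneg ξ; positivity)

theorem sum {ι : Type*} (S : Finset ι) {G : ι → ℝ → EuclideanSpace ℝ (Fin n) → ℝ}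
    (h : ∀ i ∈ S, PolyBounded T (G i)) : PolyBounded T (fun t ξ => ∑ i ∈ S, G i t ξ) := by
  classical
  induction S using Finset.induction_on with
  | empty => simpa using const (T := T) (n := n) 0
  | insert a S ha ih =>
    simp only [Finset.sum_insert ha]
    exact (h a (Finset.mem_insert_self a S)).add
      (ih fun i hi => h i (Finset.mem_insert_of_mem hi))

end PolyBounded

theorem polyBounded_norm_monomialSum {F : Type*} [NormedAddCommGroup F] [NormedSpace ℝ F] {T : ℝ}
    {S : Finset (Fin n → ℕ)} {f : (Fin n → ℕ) → ℝ → F}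
    (hf : ∀ α ∈ S, ContinuousOn (f α) (Icc 0 T)) :
    PolyBounded T (fun t ξ => ‖monomialSum S f t ξ‖) := by
  have hterm : ∀ α ∈ S, PolyBounded T
      (fun t (ξ : EuclideanSpace ℝ (Fin n)) => ‖(∏ i, ξ i ^ α i) • f α t‖) := by
    intro α hα
    obtain ⟨K, hK⟩ := isCompact_Icc.exists_bound_of_continuousOn (hf α hα)
    refine ⟨|K|, ∑ i, α i, abs_nonneg K, fun t ht ξ => ?_⟩
    rw [abs_norm, norm_smul, mul_comm, Real.norm_eq_abs]
    exact mul_le_mul ((hK t ht).trans (le_abs_self K)) (abs_prod_pow_le ξ α) (abs_nonneg _)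
      (abs_nonneg K)
  refine (PolyBounded.sum S hterm).mono fun t _ ξ => ?_
  rw [abs_norm]
  exact (norm_sum_le _ _).trans (le_abs_self _)

end PolyBounded

section SeparatedAnalytic

variable {n : ℕ}

/-- `G(t,ξ)` is a finite sum of products of an analytic function of `t ∈ [0,T]` and a function
of `ξ`. -/
def SeparatedAnalytic (T : ℝ) (G : ℝ → EuclideanSpace ℝ (Fin n) → ℝ) : Prop :=
  ∃ (ι : Type) (_ : Fintype ι) (h : ι → ℝ → ℝ) (c : EuclideanSpace ℝ (Fin n) → ι → ℝ),
    (∀ i, AnalyticOnNhd ℝ (h i) (Icc 0 T)) ∧ ∀ t ξ, G t ξ = ∑ i, c ξ i * h i t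

namespace SeparatedAnalytic

variable {T : ℝ} {G H : ℝ → EuclideanSpace ℝ (Fin n) → ℝ}

theorem const (r : ℝ) : SeparatedAnalytic T (fun _ (_ : EuclideanSpace ℝ (Fin n)) => r) :=
  ⟨Unit, inferInstance, fun _ _ => 1, fun _ _ => r, fun _ _ _ => analyticAt_const,
    fun t ξ => by simp⟩

theorem add (hG : SeparatedAnalytic T G) (hH : SeparatedAnalytic T H) :
    SeparatedAnalytic T (fun t ξ => G t ξ + H t ξ) := by
  obtain ⟨ι, _, h, c, ha, hs⟩ := hG
  obtain ⟨ι', _, h', c', ha', hs'⟩ := hH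
  refine ⟨ι ⊕ ι', inferInstance, Sum.elim h h', fun ξ => Sum.elim (c ξ) (c' ξ), ?_, ?_⟩
  · rintro (i | i)
    exacts [ha i, ha' i]
  · intro t ξ
    simp [hs, hs', Fintype.sum_sum_type]

theorem mul (hG : SeparatedAnalytic T G) (hH : SeparatedAnalytic T H) :
    SeparatedAnalytic T (fun t ξ => G t ξ * H t ξ) := by
  obtain ⟨ι, _, h, c, ha, hs⟩ := hG
  obtain ⟨ι', _, h', c', ha', hs'⟩ := hH
  refine ⟨ι × ι', inferInstance, fun p t => h p.1 t * h' p.2 t, fun ξ p => c ξ p.1 * c' ξ p.2,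
    fun p t ht => (ha p.1 t ht).mul (ha' p.2 t ht), ?_⟩
  intro t ξ
  simp only
  rw [hs, hs', Finset.sum_mul_sum, Fintype.sum_prod_type]
  exact Finset.sum_congr rfl fun i _ => Finset.sum_congr rfl fun j _ => by ring

theorem monomialSum {S : Finset (Fin n → ℕ)} {f : (Fin n → ℕ) → ℝ → ℝ}
    (hf : ∀ α ∈ S, AnalyticOnNhd ℝ (f α) (Icc 0 T)) :
    SeparatedAnalytic T (_root_.monomialSum S f) := by
  refine ⟨S, inferInstance, fun α => f α, fun ξ α => ∏ i, ξ i ^ α.1 i, fun α => hf α α.2, ?_⟩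
  intro t ξ
  rw [Finset.univ_eq_attach, Finset.sum_attach S (fun α => (∏ i, ξ i ^ α i) * f α t)]
  rfl

end SeparatedAnalytic

end SeparatedAnalytic

/-! ### The discriminant as a polynomial in the coefficients, and the symbols of the operator. -/

/-- The discriminant of `X³ + A X² + B X + D`. -/
def cubicDiscr (A B D : ℝ) : ℝ :=
  A ^ 2 * B ^ 2 - 4 * B ^ 3 - 4 * A ^ 3 * D - 27 * D ^ 2 + 18 * A * B * D

theorem cubicDiscr_eq {A B D a b c : ℝ} (hA : A = -(a + b + c)) (hB : B = a * b + b * c + c * a)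
    (hD : D = -(a * b * c)) :
    cubicDiscr A B D = (a - b) ^ 2 * (b - c) ^ 2 * (c - a) ^ 2 := by
  rw [hA, hB, hD, cubicDiscr]; ring

theorem SeparatedAnalytic.cubicDiscr {n : ℕ} {T : ℝ} {A B D : ℝ → EuclideanSpace ℝ (Fin n) → ℝ}
    (hA : SeparatedAnalytic T A) (hB : SeparatedAnalytic T B) (hD : SeparatedAnalytic T D) :
    SeparatedAnalytic T (fun t ξ => _root_.cubicDiscr (A t ξ) (B t ξ) (D t ξ)) := by
  have key := (((((hA.mul hA).mul (hB.mul hB)).add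
    ((SeparatedAnalytic.const (-4)).mul (hB.mul (hB.mul hB)))).add
    ((SeparatedAnalytic.const (-4)).mul ((hA.mul (hA.mul hA)).mul hD))).add
    ((SeparatedAnalytic.const (-27)).mul (hD.mul hD))).add
    ((SeparatedAnalytic.const 18).mul ((hA.mul hB).mul hD))
  convert key using 3
  unfold _root_.cubicDiscr
  ring

namespace ThirdOrderOperator

variable {n : ℕ} {P : ThirdOrderOperator n} {T : ℝ}

/-- The coefficient of `τ ^ j` in the principal symbol. -/
noncomputable def topSymbol (P : ThirdOrderOperator n) (j : ℕ) (t : ℝ)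
    (ξ : EuclideanSpace ℝ (Fin n)) : ℝ :=
  monomialSum (Finset.piAntidiag Finset.univ (3 - j)) (P.top j) t ξ

/-- The time derivative of the coefficient of `τ ^ j` in the principal symbol. -/
noncomputable def topSymbolDeriv (P : ThirdOrderOperator n) (j : ℕ) (t : ℝ)
    (ξ : EuclideanSpace ℝ (Fin n)) : ℝ :=
  monomialSum (Finset.piAntidiag Finset.univ (3 - j)) (fun α => deriv (P.top j α)) t ξ

/-- The coefficient of `τ ^ j` in the second order symbol `M`. -/
noncomputable def lowSymbol (P : ThirdOrderOperator n) (j : ℕ) (t : ℝ)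
    (ξ : EuclideanSpace ℝ (Fin n)) : ℂ :=
  monomialSum (Finset.piAntidiag Finset.univ (2 - j)) (P.low j) t ξ

theorem L_eq_monicCubic (P : ThirdOrderOperator n) (t : ℝ) (ξ : EuclideanSpace ℝ (Fin n)) :
    P.L t ξ = monicCubic (P.topSymbol 2 t ξ) (P.topSymbol 1 t ξ) (P.topSymbol 0 t ξ) := by
  have hj : ∀ j : ℕ, ∑ α ∈ Finset.piAntidiag (Finset.univ : Finset (Fin n)) (3 - j),
      C (P.top j α t * ∏ i, ξ i ^ α i) * X ^ j = C (P.topSymbol j t ξ) * X ^ j := by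
    intro j
    rw [topSymbol, monomialSum, map_sum, Finset.sum_mul]
    exact Finset.sum_congr rfl fun α _ => by rw [smul_eq_mul, mul_comm (P.top j α t)]
  simp only [L, hj, Finset.sum_range_succ, Finset.sum_range_zero, monicCubic]
  ring

theorem calL_eq_monicCubic (P : ThirdOrderOperator n) (t : ℝ) (ξ : EuclideanSpace ℝ (Fin n)) :
    P.calL t ξ = monicCubic (P.topSymbol 2 t ξ) (P.topSymbol 1 t ξ - 6)
      (P.topSymbol 0 t ξ - 2 * P.topSymbol 2 t ξ) := by
  rw [calL, L_eq_monicCubic, monicCubic_sub_derivative_derivative]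

theorem M_eq (P : ThirdOrderOperator n) (t τ : ℝ) (ξ : EuclideanSpace ℝ (Fin n)) :
    P.M t τ ξ = P.lowSymbol 0 t ξ + P.lowSymbol 1 t ξ * τ + P.lowSymbol 2 t ξ * τ ^ 2 := by
  have hj : ∀ j : ℕ, ∑ α ∈ Finset.piAntidiag (Finset.univ : Finset (Fin n)) (2 - j),
      P.low j α t * ((τ ^ j * ∏ i, ξ i ^ α i : ℝ) : ℂ) = P.lowSymbol j t ξ * τ ^ j := by
    intro j
    rw [lowSymbol, monomialSum, Finset.sum_mul]
    refine Finset.sum_congr rfl fun α _ => ?_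
    rw [Complex.real_smul, Complex.ofReal_mul, Complex.ofReal_pow]
    ring
  simp only [M, hj, Finset.sum_range_succ, Finset.sum_range_zero]
  ring

namespace AnalyticCoeffs

theorem analytic_top (h : P.AnalyticCoeffs T) {j : ℕ} (hj : j ≤ 2) {α : Fin n → ℕ}
    (hα : α ∈ Finset.piAntidiag (Finset.univ : Finset (Fin n)) (3 - j)) :
    AnalyticOnNhd ℝ (P.top j α) (Icc 0 T) := by
  refine h.1 j α hj ?_
  have : ∑ i, α i = 3 - j := (Finset.mem_piAntidiag.1 hα).1
  omega

theorem analytic_low (h : P.AnalyticCoeffs T) {j : ℕ} (hj : j ≤ 2) {α : Fin n → ℕ}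
    (hα : α ∈ Finset.piAntidiag (Finset.univ : Finset (Fin n)) (2 - j)) :
    AnalyticOnNhd ℝ (P.low j α) (Icc 0 T) := by
  refine h.2 j α ?_
  have : ∑ i, α i = 2 - j := (Finset.mem_piAntidiag.1 hα).1
  omega

theorem hasDerivAt_topSymbol (h : P.AnalyticCoeffs T) {j : ℕ} (hj : j ≤ 2) {t : ℝ}
    (ht : t ∈ Icc 0 T) (ξ : EuclideanSpace ℝ (Fin n)) :
    HasDerivAt (fun s => P.topSymbol j s ξ) (P.topSymbolDeriv j t ξ) t :=
  hasDerivAt_monomialSum (fun _ hα => (h.analytic_top hj hα t ht).differentiableAt) ξ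

theorem continuousOn_topSymbol (h : P.AnalyticCoeffs T) {j : ℕ} (hj : j ≤ 2) :
    ContinuousOn (fun p : ℝ × EuclideanSpace ℝ (Fin n) => P.topSymbol j p.1 p.2)
      (Icc 0 T ×ˢ univ) :=
  continuousOn_monomialSum fun _ hα => (h.analytic_top hj hα).continuousOn

theorem continuousOn_topSymbolDeriv (h : P.AnalyticCoeffs T) {j : ℕ} (hj : j ≤ 2) :
    ContinuousOn (fun p : ℝ × EuclideanSpace ℝ (Fin n) => P.topSymbolDeriv j p.1 p.2)
      (Icc 0 T ×ˢ univ) :=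
  continuousOn_monomialSum fun _ hα => (h.analytic_top hj hα).deriv.continuousOn

theorem continuousOn_lowSymbol (h : P.AnalyticCoeffs T) {j : ℕ} (hj : j ≤ 2) :
    ContinuousOn (fun p : ℝ × EuclideanSpace ℝ (Fin n) => P.lowSymbol j p.1 p.2)
      (Icc 0 T ×ˢ univ) :=
  continuousOn_monomialSum fun _ hα => (h.analytic_low hj hα).continuousOn

theorem polyBounded_topSymbol (h : P.AnalyticCoeffs T) {j : ℕ} (hj : j ≤ 2) :
    PolyBounded T (fun t ξ => ‖P.topSymbol j t ξ‖) :=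
  polyBounded_norm_monomialSum fun _ hα => (h.analytic_top hj hα).continuousOn

theorem polyBounded_topSymbolDeriv (h : P.AnalyticCoeffs T) {j : ℕ} (hj : j ≤ 2) :
    PolyBounded T (fun t ξ => ‖P.topSymbolDeriv j t ξ‖) :=
  polyBounded_norm_monomialSum fun _ hα => (h.analytic_top hj hα).deriv.continuousOn

theorem polyBounded_lowSymbol (h : P.AnalyticCoeffs T) {j : ℕ} (hj : j ≤ 2) :
    PolyBounded T (fun t ξ => ‖P.lowSymbol j t ξ‖) :=
  polyBounded_norm_monomialSum fun _ hα => (h.analytic_low hj hα).continuousOn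

end AnalyticCoeffs

/-- The discriminant of `L(t,·,ξ)` in terms of its coefficients. -/
noncomputable def coeffDiscr (P : ThirdOrderOperator n) (t : ℝ) (ξ : EuclideanSpace ℝ (Fin n)) :
    ℝ :=
  cubicDiscr (P.topSymbol 2 t ξ) (P.topSymbol 1 t ξ) (P.topSymbol 0 t ξ)

theorem AnalyticCoeffs.separatedAnalytic_coeffDiscr (h : P.AnalyticCoeffs T) :
    SeparatedAnalytic T P.coeffDiscr :=
  (SeparatedAnalytic.monomialSum fun _ hα => h.analytic_top le_rfl hα).cubicDiscr
    (SeparatedAnalytic.monomialSum fun _ hα => h.analytic_top one_le_two hα)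
    (SeparatedAnalytic.monomialSum fun _ hα => h.analytic_top zero_le_two hα)

theorem analyticAt_coeffDiscr_line (P : ThirdOrderOperator n) (t : ℝ)
    (ξ η : EuclideanSpace ℝ (Fin n)) (s : ℝ) :
    AnalyticAt ℝ (fun s : ℝ => P.coeffDiscr t (ξ + s • η)) s := by
  have hj : ∀ j, AnalyticAt ℝ (fun s : ℝ => P.topSymbol j t (ξ + s • η)) s := fun j =>
    analyticAt_monomialSum_line _ _ t ξ η s
  have h0 := hj 0
  have h1 := hj 1
  have h2 := hj 2
  unfold coeffDiscr cubicDiscr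
  fun_prop

/-- Makes `M̌` an explicit quadratic in `τ`, as interpolation, continuity and growth estimates
require. -/
theorem mCheck_eq (h : P.AnalyticCoeffs T) {t : ℝ} (ht : t ∈ Icc 0 T) (τ : ℝ)
    (ξ : EuclideanSpace ℝ (Fin n)) :
    P.MCheck t τ ξ = (P.lowSymbol 0 t ξ - (P.topSymbolDeriv 1 t ξ / 2 : ℝ)) +
      (P.lowSymbol 1 t ξ - (P.topSymbolDeriv 2 t ξ : ℝ)) * τ + P.lowSymbol 2 t ξ * τ ^ 2 := by
  have hev : (fun s => (derivative (P.L s ξ)).eval τ) =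
      fun s => 3 * τ ^ 2 + P.topSymbol 2 s ξ * (2 * τ) + P.topSymbol 1 s ξ := by
    funext s
    rw [L_eq_monicCubic, monicCubic]
    simp
    ring
  have hd : HasDerivAt (fun s => 3 * τ ^ 2 + P.topSymbol 2 s ξ * (2 * τ) + P.topSymbol 1 s ξ)
      (P.topSymbolDeriv 2 t ξ * (2 * τ) + P.topSymbolDeriv 1 t ξ) t :=
    (((h.hasDerivAt_topSymbol le_rfl ht ξ).mul_const (2 * τ)).const_add (3 * τ ^ 2)).add
      (h.hasDerivAt_topSymbol one_le_two ht ξ)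
  rw [MCheck, hev, hd.deriv, M_eq]
  push_cast
  ring

/-- The roots of `L(t,·,ξ)` and of `𝓛(t,·,ξ)`. -/
theorem WeaklyHyperbolic.roots (hh : P.WeaklyHyperbolic T) {t : ℝ} (ht : t ∈ Icc 0 T)
    (ξ : EuclideanSpace ℝ (Fin n)) :
    NuijRoots (P.tau 0 t ξ) (P.tau 1 t ξ) (P.tau 2 t ξ) (P.lam 0 t ξ) (P.lam 1 t ξ) (P.lam 2 t ξ) ∧
    P.topSymbol 2 t ξ = -(P.tau 0 t ξ + P.tau 1 t ξ + P.tau 2 t ξ) ∧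
    P.topSymbol 1 t ξ = P.tau 0 t ξ * P.tau 1 t ξ + P.tau 1 t ξ * P.tau 2 t ξ +
      P.tau 2 t ξ * P.tau 0 t ξ ∧
    P.discrL t ξ = P.coeffDiscr t ξ ∧
    (∀ j, P.lam j t ξ = vieteRoot j (P.topSymbol 2 t ξ) (P.topSymbol 1 t ξ - 6)
      (P.topSymbol 0 t ξ - 2 * P.topSymbol 2 t ξ)) ∧
    P.calL t ξ = (X - C (P.lam 0 t ξ)) * (X - C (P.lam 1 t ξ)) * (X - C (P.lam 2 t ξ)) := by
  have hs := hh t ht ξ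
  rw [L_eq_monicCubic] at hs
  obtain ⟨a, b, c, hab, hbc, hA, hB, hD, hprod⟩ := exists_ordered_roots hs
  obtain ⟨h0, h1, h2⟩ := orderedRoot_of_eq hab hbc hprod
  obtain ⟨hN, hprod'⟩ := nuijRoots_vieteRoot hab hbc hA hB hD
  obtain ⟨k0, k1, k2⟩ := orderedRoot_of_eq hN.xy hN.yz hprod'
  rw [← L_eq_monicCubic] at h0 h1 h2
  rw [← calL_eq_monicCubic] at k0 k1 k2 hprod'
  change P.tau 0 t ξ = a at h0
  change P.tau 1 t ξ = b at h1
  change P.tau 2 t ξ = c at h2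
  change P.lam 0 t ξ = _ at k0
  change P.lam 1 t ξ = _ at k1
  change P.lam 2 t ξ = _ at k2
  refine ⟨?_, ?_, ?_, ?_, ?_, ?_⟩
  · rw [h0, h1, h2, k0, k1, k2]; exact hN
  · rw [h0, h1, h2]; exact hA
  · rw [h0, h1, h2]; exact hB
  · rw [discrL, h0, h1, h2, coeffDiscr, cubicDiscr_eq hA hB hD]
  · intro j
    fin_cases j
    exacts [k0, k1, k2]
  · rw [k0, k1, k2]; exact hprod'

theorem leviIntegrand_eq (P : ThirdOrderOperator n) (ξ : EuclideanSpace ℝ (Fin n)) (t : ℝ) :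
    P.leviIntegrand ξ t =
      nodeQuotient (fun τ => P.MCheck t τ ξ) (P.lam 0 t ξ) (P.lam 1 t ξ) (P.lam 2 t ξ) +
      nodeQuotient (fun τ => P.MCheck t τ ξ) (P.lam 1 t ξ) (P.lam 2 t ξ) (P.lam 0 t ξ) +
      nodeQuotient (fun τ => P.MCheck t τ ξ) (P.lam 2 t ξ) (P.lam 0 t ξ) (P.lam 1 t ξ) := by
  rw [leviIntegrand, cyclicTriples, Finset.sum_insert (by decide), Finset.sum_insert (by decide),
    Finset.sum_singleton, ← add_assoc]
  rfl

theorem leviIntegrand_nonneg (P : ThirdOrderOperator n) (ξ : EuclideanSpace ℝ (Fin n)) (t : ℝ) :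
    0 ≤ P.leviIntegrand ξ t := by
  rw [leviIntegrand_eq]
  exact add_nonneg (add_nonneg (nodeQuotient_nonneg _ _ _ _) (nodeQuotient_nonneg _ _ _ _))
    (nodeQuotient_nonneg _ _ _ _)

end ThirdOrderOperator

/-! ### Bounds for the Levi integrand and its integral. -/

namespace ThirdOrderOperator

open Filter Topology

variable {n : ℕ} {P : ThirdOrderOperator n} {T : ℝ}

/-- The time derivative of the discriminant of `L`. -/
noncomputable def coeffDiscrDeriv (P : ThirdOrderOperator n) (t : ℝ)
    (ξ : EuclideanSpace ℝ (Fin n)) : ℝ :=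
  deriv (fun s => P.coeffDiscr s ξ) t

theorem AnalyticCoeffs.hasDerivAt_coeffDiscr (h : P.AnalyticCoeffs T) {t : ℝ} (ht : t ∈ Icc 0 T)
    (ξ : EuclideanSpace ℝ (Fin n)) :
    HasDerivAt (fun s => P.coeffDiscr s ξ) (P.coeffDiscrDeriv t ξ) t := by
  have h0 := (h.hasDerivAt_topSymbol zero_le_two ht ξ).differentiableAt
  have h1 := (h.hasDerivAt_topSymbol one_le_two ht ξ).differentiableAt
  have h2 := (h.hasDerivAt_topSymbol le_rfl ht ξ).differentiableAt
  refine DifferentiableAt.hasDerivAt ?_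
  unfold coeffDiscr cubicDiscr
  fun_prop

theorem WeaklyHyperbolic.coeffDiscr_nonneg (hh : P.WeaklyHyperbolic T) {t : ℝ} (ht : t ∈ Icc 0 T)
    (ξ : EuclideanSpace ℝ (Fin n)) : 0 ≤ P.coeffDiscr t ξ := by
  rw [← (hh.roots ht ξ).2.2.2.1, discrL]
  positivity

/-- Hyperbolicity is known on `[0,T]` only, so `discrL` need not agree with the analytic
`coeffDiscr` outside. The derivative therefore transfers only within the interval. -/
theorem hasDerivWithinAt_sqrt_discrL (h : P.AnalyticCoeffs T) (hh : P.WeaklyHyperbolic T) {t : ℝ}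
    (ht : t ∈ Icc 0 T) {ξ : EuclideanSpace ℝ (Fin n)} (hD : P.coeffDiscr t ξ ≠ 0) :
    HasDerivWithinAt (fun s => √(P.discrL s ξ))
      (P.coeffDiscrDeriv t ξ / (2 * √(P.coeffDiscr t ξ))) (Icc 0 T) t := by
  refine ((h.hasDerivAt_coeffDiscr ht ξ).sqrt hD).hasDerivWithinAt.congr (fun s hs => ?_) ?_
  · rw [(hh.roots hs ξ).2.2.2.1]
  · rw [(hh.roots ht ξ).2.2.2.1]

/-- Where `Δ_L ≠ 0`, the pointwise condition bounds the Levi integrand by the logarithmic derivative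
of the discriminant. -/
theorem exists_leviIntegrand_le (hT : 0 < T) (h : P.AnalyticCoeffs T) (hh : P.WeaklyHyperbolic T)
    (hb : P.PointwiseBound T) :
    ∃ K : ℝ, 0 < K ∧ ∀ t ∈ Icc 0 T, ∀ ξ : EuclideanSpace ℝ (Fin n), P.coeffDiscr t ξ ≠ 0 →
      P.leviIntegrand ξ t ≤ K * (1 + |P.coeffDiscrDeriv t ξ| / P.coeffDiscr t ξ) := by
  obtain ⟨K, hK, hb⟩ := hb
  -- `144 = 3 · 16 · 3`: three terms in the integrand, the interpolation constant, three nodes each.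
  refine ⟨144 * K, by positivity, fun t ht ξ hD => ?_⟩
  obtain ⟨hN, -, -, hdisc, -, -⟩ := hh.roots ht ξ
  have hD0 : 0 < P.coeffDiscr t ξ := lt_of_le_of_ne (hh.coeffDiscr_nonneg ht ξ) hD.symm
  have hder := hasDerivWithinAt_sqrt_discrL h hh ht hD
  have hdw := hder.derivWithin (uniqueDiffOn_Icc hT t ht)
  have hbd := fun q hq => hb q hq t ht ξ hder.differentiableWithinAt
  simp only [hdw, hdisc] at hbd
  obtain ⟨N, hNdef⟩ : ∃ N : ℝ → ℂ, N = fun τ => P.MCheck t τ ξ := ⟨_, rfl⟩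
  have hquad : ∀ x : ℝ, N x = _ + _ * (x : ℂ) + _ * (x : ℂ) ^ 2 := fun x => by
    rw [hNdef]; exact mCheck_eq h ht x ξ
  rw [leviIntegrand_eq, ← hNdef]
  have b0 := hbd (0, 1, 2) (by decide)
  have b1 := hbd (1, 2, 0) (by decide)
  have b2 := hbd (2, 0, 1) (by decide)
  simp only [← congrFun hNdef _] at b0 b1 b2
  rw [discrL] at hdisc
  generalize P.tau 0 t ξ = a at *
  generalize P.tau 1 t ξ = b at *
  generalize P.tau 2 t ξ = c at *
  generalize P.lam 0 t ξ = x at *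
  generalize P.lam 1 t ξ = y at *
  generalize P.lam 2 t ξ = z at *
  generalize P.coeffDiscrDeriv t ξ = D' at *
  generalize P.coeffDiscr t ξ = D at *
  have hab : a ≠ b := by rintro rfl; simp at hdisc; exact hD hdisc.symm
  have hbc : b ≠ c := by rintro rfl; simp at hdisc; exact hD hdisc.symm
  have hca : c ≠ a := by rintro rfl; simp at hdisc; exact hD hdisc.symm
  have hsq0 : 0 < √D := Real.sqrt_pos.2 hD0
  have hsq : √D = |a - b| * |b - c| * |c - a| := by
    rw [← hdisc, ← mul_pow, ← mul_pow, Real.sqrt_sq_eq_abs, abs_mul, abs_mul]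
  have hrhs : K * (√D + |D' / (2 * √D)|) ≤ K * (1 + |D'| / D) * √D := by
    rw [mul_assoc]
    refine mul_le_mul_of_nonneg_left ?_ hK.le
    rw [add_mul, one_mul, abs_div, abs_of_pos (by positivity : 0 < 2 * √D)]
    have : |D'| / D * √D = |D'| / √D := by
      rw [div_mul_eq_mul_div, div_eq_div_iff hD0.ne' hsq0.ne', mul_assoc,
        Real.mul_self_sqrt hD0.le]
    rw [this]
    have : |D'| / (2 * √D) ≤ |D'| / √D :=
      div_le_div_of_nonneg_left (abs_nonneg _) hsq0 (by linarith)
    linarith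
  have node : ∀ p q r : ℝ, √D = |p - q| * |q - r| * |r - p| → p ≠ q → q ≠ r → r ≠ p →
      |q - r| * ‖N p‖ ≤ K * (√D + |D' / (2 * √D)|) →
      nodeQuotient N p q r ≤ K * (1 + |D'| / D) := by
    intro p q r hs hpq hqr hrp hle
    have h1 : 0 < |p - q| := abs_pos.2 (sub_ne_zero.2 hpq)
    have h2 : 0 < |q - r| := abs_pos.2 (sub_ne_zero.2 hqr)
    have h3 : 0 < |p - r| := abs_pos.2 (sub_ne_zero.2 hrp.symm)
    rw [nodeQuotient, div_le_iff₀ (by positivity)]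
    refine le_of_mul_le_mul_left ?_ h2
    refine (hle.trans hrhs).trans_eq ?_
    rw [hs, abs_sub_comm r p]
    ring
  have n0 := node a b c hsq hab hbc hca b0
  have n1 := node b c a (by rw [hsq]; ring) hbc hca hab b1
  have n2 := node c a b (by rw [hsq]; ring) hca hab hbc b2
  have gxy : 1 ≤ |x - y| := by rw [abs_sub_comm]; exact hN.one_le_gap.trans (le_abs_self _)
  have gyz : 1 ≤ |y - z| := by rw [abs_sub_comm]; exact hN.one_le_gap'.trans (le_abs_self _)
  have gzx : 1 ≤ |z - x| := by
    refine le_trans ?_ (le_abs_self _)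
    linarith [hN.one_le_gap, hN.one_le_gap']
  have d0 := hN.abs_first_sub_le
  have d1 := hN.abs_middle_sub_le
  have d2 := hN.abs_last_sub_le
  have l0 := nodeQuotient_le hquad hab hbc hca gxy (by rwa [abs_sub_comm]) d0 d1 d2
  have l1 := nodeQuotient_le hquad hbc hca hab gyz (by rwa [abs_sub_comm]) d1 d2 d0
  have l2 := nodeQuotient_le hquad hca hab hbc gzx (by rwa [abs_sub_comm]) d2 d0 d1
  linarith

theorem one_le_abs_lam_sub (hh : P.WeaklyHyperbolic T) {t : ℝ} (ht : t ∈ Icc 0 T)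
    (ξ : EuclideanSpace ℝ (Fin n)) {i j : Fin 3} (hij : i ≠ j) :
    1 ≤ |P.lam i t ξ - P.lam j t ξ| := by
  obtain ⟨hN, -⟩ := hh.roots ht ξ
  have h1 := hN.one_le_gap
  have h2 := hN.one_le_gap'
  fin_cases i <;> fin_cases j <;> simp only [Fin.mk_zero, Fin.mk_one, Fin.reduceFinMk] at hij ⊢ <;>
    first
    | exact absurd rfl hij
    | (refine le_trans ?_ (le_abs_self _); linarith)
    | (rw [abs_sub_comm]; refine le_trans ?_ (le_abs_self _); linarith)

/-- The sum of the `τ_j²` is `A² - 2B` in terms of the coefficients; with `|u| ≤ 1 + u²` and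
displacement 3 this gives the constant 4. -/
theorem abs_lam_le (hh : P.WeaklyHyperbolic T) {t : ℝ} (ht : t ∈ Icc 0 T)
    (ξ : EuclideanSpace ℝ (Fin n)) (j : Fin 3) :
    |P.lam j t ξ| ≤ 4 + ‖P.topSymbol 2 t ξ‖ * ‖P.topSymbol 2 t ξ‖ + 2 * ‖P.topSymbol 1 t ξ‖ := by
  obtain ⟨hN, hA, hB, -⟩ := hh.roots ht ξ
  have key : P.tau 0 t ξ ^ 2 + P.tau 1 t ξ ^ 2 + P.tau 2 t ξ ^ 2 =
      P.topSymbol 2 t ξ ^ 2 - 2 * P.topSymbol 1 t ξ := by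
    rw [hA, hB]; ring
  have hB' : -P.topSymbol 1 t ξ ≤ ‖P.topSymbol 1 t ξ‖ := neg_le_abs _
  have hA' : P.topSymbol 2 t ξ ^ 2 = ‖P.topSymbol 2 t ξ‖ * ‖P.topSymbol 2 t ξ‖ := by
    rw [Real.norm_eq_abs, abs_mul_abs_self, sq]
  have aux : ∀ x u : ℝ, |x - u| ≤ 3 →
      u ^ 2 ≤ P.topSymbol 2 t ξ ^ 2 - 2 * P.topSymbol 1 t ξ →
      |x| ≤ 4 + ‖P.topSymbol 2 t ξ‖ * ‖P.topSymbol 2 t ξ‖ + 2 * ‖P.topSymbol 1 t ξ‖ := by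
    intro x u hx hu
    have h1 : |x| ≤ |x - u| + |u| := by simpa using abs_add_le (x - u) u
    have h2 : |u| ≤ 1 + u ^ 2 := by
      rw [← sq_abs u]
      nlinarith [sq_nonneg (|u| - 1), abs_nonneg u]
    linarith
  have s0 := sq_nonneg (P.tau 0 t ξ)
  have s1 := sq_nonneg (P.tau 1 t ξ)
  have s2 := sq_nonneg (P.tau 2 t ξ)
  fin_cases j
  · exact aux _ _ hN.abs_first_sub_le (by linarith)
  · exact aux _ _ hN.abs_middle_sub_le (by linarith)
  · exact aux _ _ hN.abs_last_sub_le (by linarith)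

theorem polyBounded_leviIntegrand (h : P.AnalyticCoeffs T) (hh : P.WeaklyHyperbolic T) :
    PolyBounded T (fun t ξ => P.leviIntegrand ξ t) := by
  obtain ⟨Λ, hΛ⟩ : ∃ Λ : ℝ → EuclideanSpace ℝ (Fin n) → ℝ, Λ = fun t ξ =>
    4 + ‖P.topSymbol 2 t ξ‖ * ‖P.topSymbol 2 t ξ‖ + 2 * ‖P.topSymbol 1 t ξ‖ := ⟨_, rfl⟩
  have pA := h.polyBounded_topSymbol (j := 2) le_rfl
  have pB := h.polyBounded_topSymbol (j := 1) one_le_two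
  have pA' := h.polyBounded_topSymbolDeriv (j := 2) le_rfl
  have pB' := h.polyBounded_topSymbolDeriv (j := 1) one_le_two
  have p0 := h.polyBounded_lowSymbol (j := 0) zero_le_two
  have p1 := h.polyBounded_lowSymbol (j := 1) one_le_two
  have p2 := h.polyBounded_lowSymbol (j := 2) le_rfl
  have pΛ : PolyBounded T Λ := hΛ ▸
    ((PolyBounded.const 4).add (pA.mul pA)).add ((PolyBounded.const 2).mul pB)
  have pG := (PolyBounded.const 3).mul
    (((p0.add pB').add ((p1.add pA').mul pΛ)).add (p2.mul (pΛ.mul pΛ)))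
  refine pG.mono fun t ht ξ => ?_
  rw [abs_of_nonneg (P.leviIntegrand_nonneg ξ t)]
  refine le_trans ?_ (le_abs_self _)
  have hlam : ∀ j, |P.lam j t ξ| ≤ Λ t ξ := fun j => by rw [hΛ]; exact abs_lam_le hh ht ξ j
  have node : ∀ i j k, i ≠ j → i ≠ k →
      nodeQuotient (fun τ => P.MCheck t τ ξ) (P.lam i t ξ) (P.lam j t ξ) (P.lam k t ξ) ≤
        ‖P.lowSymbol 0 t ξ‖ + ‖P.topSymbolDeriv 1 t ξ‖ +
          (‖P.lowSymbol 1 t ξ‖ + ‖P.topSymbolDeriv 2 t ξ‖) * Λ t ξ +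
          ‖P.lowSymbol 2 t ξ‖ * (Λ t ξ * Λ t ξ) := by
    intro i j k hij hik
    have hden : 1 ≤ |P.lam i t ξ - P.lam j t ξ| * |P.lam i t ξ - P.lam k t ξ| :=
      one_le_mul_of_one_le_of_one_le (one_le_abs_lam_sub hh ht ξ hij)
        (one_le_abs_lam_sub hh ht ξ hik)
    refine (div_le_self (norm_nonneg _) hden).trans ?_
    simp only
    rw [mCheck_eq h ht]
    have hl : ‖(P.lam i t ξ : ℂ)‖ ≤ Λ t ξ := by rw [Complex.norm_real]; exact hlam i
    refine norm_add₃_le.trans (add_le_add (add_le_add ?_ ?_) ?_)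
    · refine (norm_sub_le _ _).trans (add_le_add le_rfl ?_)
      rw [Complex.norm_real, norm_div]
      refine div_le_self (norm_nonneg _) (by norm_num)
    · rw [norm_mul]
      refine mul_le_mul ((norm_sub_le _ _).trans (add_le_add le_rfl ?_)) hl (norm_nonneg _)
        (by positivity)
      rw [Complex.norm_real]
    · rw [norm_mul, norm_pow, sq]
      exact mul_le_mul_of_nonneg_left
        (mul_le_mul hl hl (norm_nonneg _) ((norm_nonneg _).trans hl)) (norm_nonneg _)
  rw [leviIntegrand_eq]
  have n0 := node 0 1 2 (by decide) (by decide)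
  have n1 := node 1 2 0 (by decide) (by decide)
  have n2 := node 2 0 1 (by decide) (by decide)
  linarith

theorem continuousOn_leviIntegrand (h : P.AnalyticCoeffs T) (hh : P.WeaklyHyperbolic T) :
    ContinuousOn (fun p : ℝ × EuclideanSpace ℝ (Fin n) => P.leviIntegrand p.2 p.1)
      (Icc 0 T ×ˢ univ) := by
  have hA := h.continuousOn_topSymbol (j := 2) le_rfl
  have hB := h.continuousOn_topSymbol (j := 1) one_le_two
  have hD := h.continuousOn_topSymbol (j := 0) zero_le_two
  have hA' := h.continuousOn_topSymbolDeriv (j := 2) le_rfl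
  have hB' := h.continuousOn_topSymbolDeriv (j := 1) one_le_two
  have h0 := h.continuousOn_lowSymbol (j := 0) zero_le_two
  have h1 := h.continuousOn_lowSymbol (j := 1) one_le_two
  have h2 := h.continuousOn_lowSymbol (j := 2) le_rfl
  have hlam : ∀ j, ContinuousOn (fun p : ℝ × EuclideanSpace ℝ (Fin n) => P.lam j p.1 p.2)
      (Icc 0 T ×ˢ univ) := by
    intro j
    refine (ContinuousOn.vieteRoot hA (hB.sub continuousOn_const)
      (hD.sub (hA.const_mul 2)) (fun p hp => ?_) j).congr fun p hp => (hh.roots hp.1 p.2).2.2.2.2.1 j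
    obtain ⟨-, eA, eB, -⟩ := hh.roots hp.1 p.2
    have := depressedP_nonneg eA eB
    unfold depressedP at this ⊢
    rw [Pi.sub_apply]
    linarith
  have hM : ∀ j, ContinuousOn
      (fun p : ℝ × EuclideanSpace ℝ (Fin n) => P.MCheck p.1 (P.lam j p.1 p.2) p.2)
      (Icc 0 T ×ˢ univ) := by
    intro j
    have hc := Complex.continuous_ofReal.comp_continuousOn (hlam j)
    have hcA := Complex.continuous_ofReal.comp_continuousOn hA'
    have hcB := Complex.continuous_ofReal.comp_continuousOn (hB'.div_const 2)
    exact (((h0.sub hcB).add ((h1.sub hcA).mul hc)).add (h2.mul (hc.pow 2))).congr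
      fun p hp => mCheck_eq h hp.1 _ _
  unfold leviIntegrand
  refine continuousOn_finsetSum _ fun q hq => ?_
  refine (hM q.1).norm.div (((hlam _).sub (hlam _)).abs.mul ((hlam _).sub (hlam _)).abs) ?_
  intro p hp
  have hne : q.1 ≠ q.2.1 ∧ q.1 ≠ q.2.2 := by
    revert q
    decide
  have g1 := one_le_abs_lam_sub hh hp.1 p.2 hne.1
  have g2 := one_le_abs_lam_sub hh hp.1 p.2 hne.2
  have : 0 < |P.lam q.1 p.1 p.2 - P.lam q.2.1 p.1 p.2| * |P.lam q.1 p.1 p.2 - P.lam q.2.2 p.1 p.2| :=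
    by positivity
  exact this.ne'

theorem continuousOn_leviIntegrand_time (h : P.AnalyticCoeffs T) (hh : P.WeaklyHyperbolic T)
    (ξ : EuclideanSpace ℝ (Fin n)) : ContinuousOn (P.leviIntegrand ξ) (Icc 0 T) :=
  (continuousOn_leviIntegrand h hh).comp (f := fun t => (t, ξ)) (by fun_prop)
    fun _ ht => ⟨ht, mem_univ _⟩

theorem continuous_leviIntegrand_space (h : P.AnalyticCoeffs T) (hh : P.WeaklyHyperbolic T)
    {t : ℝ} (ht : t ∈ Icc 0 T) :
    Continuous (fun ξ : EuclideanSpace ℝ (Fin n) => P.leviIntegrand ξ t) :=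
  (continuousOn_leviIntegrand h hh).comp_continuous (f := fun ξ => (t, ξ)) (by fun_prop)
    fun _ => ⟨ht, mem_univ _⟩

/-- The Levi bound, uniform in the frequencies for which the discriminant is not identically zero. -/
theorem exists_lintegral_leviIntegrand_le (hT : 0 < T) (h : P.AnalyticCoeffs T)
    (hh : P.WeaklyHyperbolic T) (hb : P.PointwiseBound T) {r : ℝ} (hr : 0 < r) :
    ∃ K : ℝ, 0 < K ∧ ∀ ξ : EuclideanSpace ℝ (Fin n), r ≤ ‖ξ‖ →
      (∃ t ∈ Icc 0 T, P.coeffDiscr t ξ ≠ 0) →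
      ∫⁻ t in Icc 0 T, ENNReal.ofReal (P.leviIntegrand ξ t) ≤
        ENNReal.ofReal (K * Real.log (1 + ‖ξ‖)) := by
  obtain ⟨K₀, hK₀, hpt⟩ := exists_leviIntegrand_le hT h hh hb
  obtain ⟨K₁, N, hK₁, hpoly⟩ := polyBounded_leviIntegrand h hh
  obtain ⟨ι, _, g, c, hg, hsum⟩ := h.separatedAnalytic_coeffDiscr
  obtain ⟨K₂, hK₂, hlog⟩ := exists_uniform_logDerivBound hg
  set ℓ₀ : ℝ := Real.log (1 + r) with hℓ₀
  have hℓ₀0 : 0 < ℓ₀ := Real.log_pos (by linarith)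
  -- The truncation height is `R = B (1 + |ξ|) ^ N`: the 2 ensures `R ≥ 2`, and `K₁ / K₀` makes `R`
  -- dominate the integrand divided by `K₀`.
  set B : ℝ := 2 + K₁ / K₀ with hB
  have hB2 : 2 ≤ B := by
    have : 0 ≤ K₁ / K₀ := by positivity
    linarith
  have hlB : 0 ≤ Real.log B := Real.log_nonneg (by linarith)
  refine ⟨K₀ * (K₂ * (Real.log B / ℓ₀ + N) + T / ℓ₀), by positivity, fun ξ hξ hne => ?_⟩
  have hℓ : ℓ₀ ≤ Real.log (1 + ‖ξ‖) := Real.log_le_log (by linarith) (by linarith)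
  have h1ξ : 1 ≤ 1 + ‖ξ‖ := by linarith [norm_nonneg ξ]
  have hpow : 1 ≤ (1 + ‖ξ‖) ^ N := one_le_pow₀ h1ξ
  set v : EuclideanSpace ℝ ι := WithLp.toLp 2 (c ξ) with hv
  have hval : ∀ t, combDeriv g v 0 t = P.coeffDiscr t ξ := fun t => by
    rw [hsum]; rfl
  have hval' : ∀ t ∈ Icc 0 T, combDeriv g v 1 t = P.coeffDiscrDeriv t ξ := by
    intro t ht
    have := isDerivTower_combDeriv hg v 0 t ht
    rw [funext hval] at this
    exact this.unique (h.hasDerivAt_coeffDiscr ht ξ)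
  have hker : v ∉ combKer g T := by
    obtain ⟨t, ht, hD⟩ := hne
    exact fun hmem => hD (by rw [← hval]; exact hmem 0 t ht)
  have hmain := hlog v hker (fun t ht => by rw [hval]; exact hh.coeffDiscr_nonneg ht ξ)
    (B * (1 + ‖ξ‖) ^ N) (fun t => P.leviIntegrand ξ t / K₀ - 1)
    (by nlinarith) (fun t ht => by
      have h1 := (le_abs_self _).trans (hpoly t ht ξ)
      have h2 : P.leviIntegrand ξ t / K₀ ≤ K₁ / K₀ * (1 + ‖ξ‖) ^ N := by
        rw [div_mul_eq_mul_div]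
        exact div_le_div_of_nonneg_right h1 hK₀.le
      rw [hB, add_mul]
      linarith)
    (fun t ht => by
      rw [hval, hval' t ht]
      have hD0 := hh.coeffDiscr_nonneg ht ξ
      -- At zeros of the discriminant the required inequality reads `0 ≤ |∂ₜΔ|`, so nothing is
      -- needed from the pointwise hypothesis there.
      rcases hD0.eq_or_lt with h0 | hpos
      · rw [← h0, mul_zero]; exact abs_nonneg _
      · have h1 := hpt t ht ξ hpos.ne'
        rw [← le_div_iff₀ hpos, sub_le_iff_le_add', div_le_iff₀' hK₀]
        exact h1)
  rw [inter_self] at hmain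
  have hle : ∀ t, ENNReal.ofReal (P.leviIntegrand ξ t) ≤
      ENNReal.ofReal K₀ * (ENNReal.ofReal (P.leviIntegrand ξ t / K₀ - 1) + ENNReal.ofReal 1) := by
    intro t
    calc ENNReal.ofReal (P.leviIntegrand ξ t)
        = ENNReal.ofReal K₀ * ENNReal.ofReal (P.leviIntegrand ξ t / K₀ - 1 + 1) := by
          rw [← ENNReal.ofReal_mul hK₀.le, sub_add_cancel, mul_div_cancel₀ _ hK₀.ne']
      _ ≤ _ := mul_le_mul_right ENNReal.ofReal_add_le _
  calc ∫⁻ t in Icc 0 T, ENNReal.ofReal (P.leviIntegrand ξ t)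
      ≤ ∫⁻ t in Icc 0 T, ENNReal.ofReal K₀ *
          (ENNReal.ofReal (P.leviIntegrand ξ t / K₀ - 1) + ENNReal.ofReal 1) := lintegral_mono hle
    _ = ENNReal.ofReal K₀ * ((∫⁻ t in Icc 0 T, ENNReal.ofReal (P.leviIntegrand ξ t / K₀ - 1)) +
          ENNReal.ofReal T) := by
        rw [lintegral_const_mul' _ _ ENNReal.ofReal_ne_top,
          lintegral_add_right _ measurable_const, setLIntegral_const, Real.volume_Icc]
        simp
    _ ≤ ENNReal.ofReal K₀ * (ENNReal.ofReal (K₂ * Real.log (B * (1 + ‖ξ‖) ^ N)) +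
          ENNReal.ofReal T) := by gcongr
    _ ≤ _ := by
        have hl : 0 ≤ Real.log (B * (1 + ‖ξ‖) ^ N) :=
          Real.log_nonneg (one_le_mul_of_one_le_of_one_le (by linarith) hpow)
        rw [← ENNReal.ofReal_add (by positivity) hT.le, ← ENNReal.ofReal_mul hK₀.le]
        apply ENNReal.ofReal_le_ofReal
        rw [mul_assoc]
        refine mul_le_mul_of_nonneg_left ?_ hK₀.le
        -- The restriction `|ξ| ≥ r` enters here: constants are absorbed using `log (1 + |ξ|) ≥ log
        -- (1 + r) > 0`.
        have hsc : ∀ w, 0 ≤ w → w ≤ w / ℓ₀ * Real.log (1 + ‖ξ‖) := by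
          intro w hw
          rw [div_mul_eq_mul_div, le_div_iff₀ hℓ₀0]
          exact mul_le_mul_of_nonneg_left hℓ hw
        rw [Real.log_mul (by positivity) (by positivity), Real.log_pow, add_mul, mul_assoc]
        refine add_le_add (mul_le_mul_of_nonneg_left ?_ hK₂.le) (hsc T hT.le)
        rw [add_mul]
        exact add_le_add (hsc _ hlB) le_rfl

/-- The Levi bound extends by continuity to all frequencies. -/
theorem exists_lintegral_leviIntegrand_le' (hT : 0 < T) (h : P.AnalyticCoeffs T)
    (hh : P.WeaklyHyperbolic T) (hb : P.PointwiseBound T)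
    (hdisc : ∃ t ∈ Icc 0 T, ∃ ξ : EuclideanSpace ℝ (Fin n), P.coeffDiscr t ξ ≠ 0)
    {r : ℝ} (hr : 0 < r) :
    ∃ K : ℝ, 0 < K ∧ ∀ ξ : EuclideanSpace ℝ (Fin n), r ≤ ‖ξ‖ →
      ∫⁻ t in Icc 0 T, ENNReal.ofReal (P.leviIntegrand ξ t) ≤
        ENNReal.ofReal (K * Real.log (1 + ‖ξ‖)) := by
  -- The radius is halved because the approximating frequencies may have norm slightly below `r`.
  obtain ⟨K, hK, H⟩ := exists_lintegral_leviIntegrand_le hT h hh hb (half_pos hr)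
  refine ⟨K, hK, fun ξ hξ => ?_⟩
  obtain ⟨t₁, ht₁, ξ₁, hξ₁⟩ := hdisc
  set γ : ℝ → EuclideanSpace ℝ (Fin n) := fun s => ξ + s • (ξ₁ - ξ) with hγ
  have hγc : Continuous γ := by fun_prop
  have hγ0 : Tendsto γ (𝓝[≠] 0) (𝓝 ξ) := by
    have : Tendsto γ (𝓝 0) (𝓝 (γ 0)) := hγc.tendsto 0
    rw [show γ 0 = ξ by simp [hγ]] at this
    exact this.mono_left nhdsWithin_le_nhds
  have han : AnalyticOnNhd ℝ (fun s => P.coeffDiscr t₁ (γ s)) univ := fun s _ =>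
    P.analyticAt_coeffDiscr_line t₁ ξ (ξ₁ - ξ) s
  -- The discriminant at time `t₁` is analytic along the line and nonzero at `γ 1 = ξ₁`, so its
  -- zeros cannot accumulate at `s = 0`.
  have hne : ∀ᶠ s in 𝓝[≠] (0 : ℝ), P.coeffDiscr t₁ (γ s) ≠ 0 := by
    rcases (han 0 (mem_univ _)).eventually_eq_zero_or_eventually_ne_zero with h0 | h0
    · have h1 := han.eqOn_zero_of_preconnected_of_eventuallyEq_zero isPreconnected_univ
        (mem_univ 0) h0 (mem_univ 1)
      exact absurd h1 (by simpa [hγ] using hξ₁)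
    · exact h0
  have hbig : ∀ᶠ s in 𝓝[≠] (0 : ℝ), r / 2 ≤ ‖γ s‖ :=
    (hγ0.norm.eventually_const_lt (by linarith : r / 2 < ‖ξ‖)).mono fun s hs => hs.le
  have hlim : ∀ t ∈ Icc 0 T, Tendsto (fun s => ENNReal.ofReal (P.leviIntegrand (γ s) t))
      (𝓝[≠] 0) (𝓝 (ENNReal.ofReal (P.leviIntegrand ξ t))) := fun t ht =>
    ENNReal.tendsto_ofReal (((continuous_leviIntegrand_space h hh ht).tendsto ξ).comp hγ0)
  have hrhs : Tendsto (fun s => ENNReal.ofReal (K * Real.log (1 + ‖γ s‖))) (𝓝[≠] 0)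
      (𝓝 (ENNReal.ofReal (K * Real.log (1 + ‖ξ‖)))) := by
    refine ENNReal.tendsto_ofReal (Tendsto.const_mul K ?_)
    exact (hγ0.norm.const_add 1).log (by positivity)
  calc ∫⁻ t in Icc 0 T, ENNReal.ofReal (P.leviIntegrand ξ t)
      = ∫⁻ t in Icc 0 T, liminf (fun s => ENNReal.ofReal (P.leviIntegrand (γ s) t)) (𝓝[≠] 0) :=
        setLIntegral_congr_fun measurableSet_Icc fun t ht => (hlim t ht).liminf_eq.symm
    _ ≤ liminf (fun s => ∫⁻ t in Icc 0 T, ENNReal.ofReal (P.leviIntegrand (γ s) t)) (𝓝[≠] 0) :=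
        lintegral_liminf_le' fun s =>
          ((continuousOn_leviIntegrand_time h hh (γ s)).aemeasurable
            measurableSet_Icc).ennreal_ofReal
    _ ≤ liminf (fun s => ENNReal.ofReal (K * Real.log (1 + ‖γ s‖))) (𝓝[≠] 0) := by
        refine liminf_le_liminf ?_
        filter_upwards [hne, hbig] with s hs hs'
        exact H (γ s) hs' ⟨t₁, ht₁, hs⟩
    _ = ENNReal.ofReal (K * Real.log (1 + ‖ξ‖)) := hrhs.liminf_eq

theorem WeaklyHyperbolic.calL_splits_and_nodup (hh : P.WeaklyHyperbolic T) {t : ℝ}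
    (ht : t ∈ Icc 0 T) (ξ : EuclideanSpace ℝ (Fin n)) :
    (P.calL t ξ).Splits ∧ (P.calL t ξ).roots.Nodup := by
  obtain ⟨hN, -, -, -, -, hprod⟩ := hh.roots ht ξ
  have h1 := hN.one_le_gap
  have h2 := hN.one_le_gap'
  refine ⟨?_, ?_⟩
  · rw [hprod]
    exact ((Splits.X_sub_C _).mul (Splits.X_sub_C _)).mul (Splits.X_sub_C _)
  · have hr : (P.calL t ξ).roots = ([P.lam 0 t ξ, P.lam 1 t ξ, P.lam 2 t ξ] : Multiset ℝ) := by
      rw [hprod, roots_mul (by simp [X_sub_C_ne_zero]), roots_mul (by simp [X_sub_C_ne_zero])]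
      simp only [roots_X_sub_C]
      rfl
    rw [hr, Multiset.coe_nodup]
    have e1 : P.lam 0 t ξ ≠ P.lam 1 t ξ := by linarith
    have e2 : P.lam 0 t ξ ≠ P.lam 2 t ξ := by linarith
    have e3 : P.lam 1 t ξ ≠ P.lam 2 t ξ := by linarith
    simp [e1, e2, e3]

end ThirdOrderOperator

theorem mainTheorem8 (n : ℕ) (T : ℝ) (hT : 0 < T) (P : ThirdOrderOperator n)
    (hana : P.AnalyticCoeffs T)
    (hhyp : P.WeaklyHyperbolic T)
    (hdisc : ∃ t ∈ Set.Icc 0 T, ∃ ξ : EuclideanSpace ℝ (Fin n), P.discrL t ξ ≠ 0)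
    (hbound : P.PointwiseBound T) :
    P.LeviCondition T := by
  refine ⟨fun t ht ξ _ => hhyp.calL_splits_and_nodup ht ξ, fun r hr => ?_⟩
  have hdisc' : ∃ t ∈ Icc 0 T, ∃ ξ : EuclideanSpace ℝ (Fin n), P.coeffDiscr t ξ ≠ 0 := by
    obtain ⟨t, ht, ξ, hne⟩ := hdisc
    exact ⟨t, ht, ξ, by rwa [← (hhyp.roots ht ξ).2.2.2.1]⟩
  obtain ⟨K, hK, H⟩ :=
    ThirdOrderOperator.exists_lintegral_leviIntegrand_le' hT hana hhyp hbound hdisc' hr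
  refine ⟨K, hK, fun ξ hξ => ?_⟩
  have hc := ThirdOrderOperator.continuousOn_leviIntegrand_time hana hhyp ξ
  refine ⟨ContinuousOn.intervalIntegrable (by rwa [uIcc_of_le hT.le]), ?_⟩
  rw [intervalIntegral.integral_of_le hT.le, ← integral_Icc_eq_integral_Ioc,
    integral_eq_lintegral_of_nonneg_ae
      (Filter.Eventually.of_forall fun t => P.leviIntegrand_nonneg ξ t)
      (hc.aestronglyMeasurable measurableSet_Icc)]
  refine ENNReal.toReal_le_of_le_ofReal ?_ (H ξ hξ)
  exact mul_nonneg hK.le (Real.log_nonneg (by linarith [norm_nonneg ξ]))
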